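/- **Names, moves, histories.** Types are $\theta::=\mathsf{unit}\mid\mathsf{int}\mid\theta\times\theta\mid\theta\to\theta$. There are countably many method names of each type $\theta\to\theta'$. Values are $v::=()\mid i\mid m\mid\langle v,v\rangle$ ($i$ an integer, $m$ a method name). A move is $(t,\mathsf{call}\,m(v))_{XY}$ or $(t,\mathsf{ret}\,m(v))_{XY}$, with $t$ a thread number, $X\in\{O,P\}$ (environment/library), $Y\in\{\mathcal K,\mathcal L\}$ (client/parameter library). Prehistories are given by $H_X::=\epsilon\mid \mathsf{call}\,m(v)_{XY}\,H_{X'}\,\mathsf{ret}\,m(v')_{X'Y}\,H_X$ with $\{X,X'\}=\{O,P\}$ and $v,v'$ of the argument and result type of $m$. For finite sets $\Theta,\Theta'$ of method names, $\mathcal H_{\Theta,\Theta'}$ is the set of all interleavings $h$ of threads $1,\dots,N$ ($N>0$), each an $H_O$ decorated with its thread number, such that (1) for each call of $m$ with polarity $XY$ in $h$: $m\in\Theta'$ and $XY=O\mathcal K$, or $m\in\Theta$ and $XY=P\mathcal L$, or $m$ occurs in the value of an earlier move of polarity $X'Y$, $X'\ne X$; (2) a method name in the value of a move does not occur in any earlier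 move. A history is *sequential* if it has the form $(t_1,x_1)_{O}(t_1,x_1')_{P}\cdots(t_k,x_k)_{O}(t_k,x_k')_{P}$, and *encapsulated* if, whenever a $P$-move of a thread with second index $Y$ is followed, as the next move of the same thread, by an $O$-move with second index $Y'$, then $Y=Y'$; $\mathcal H^{\sf seq}$, $\mathcal H^{\sf enc}$ are the corresponding subsets. **Language.** Terms are $M::=()\mid i\mid \mathsf{tid}\mid x\mid m\mid M\oplus M\mid \mathsf{if}\,M\,\mathsf{then}\,M\,\mathsf{else}\,M\mid\langle M,M\rangle\mid\pi_jM\mid\lambda x^\theta.M\mid xM\mid mM\mid\mathsf{let}\,x=M\,\mathsf{in}\,M\mid r:=M\mid {!r}\mid \mathsf{acquire}\,r\mid\mathsf{release}\,r$, simply typed, where $r$ ranges over references to integers or to methods; $\oplus$ is integer arithmetic or comparison (with results $1$ and $0$). They are reduced call-by-value, left to right, with atomic steps, relative to a repository $R$ (a finite map from method names to abstractions) and a store $S$; a thread evaluates $\lambda x.M$ by adding a fresh name of its type to $R$, and $mv$ with $R(m)=\lambda x.M$ by $M\{v/x\}$; $\mathsf{acquire}\,r$ atomically changes $S(r)$ from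 $0$ to $1$ and is blocked if $S(r)\neq0$; $\mathsf{release}\,r$ sets $S(r)$ to $0$. A library $L:\Theta\to\Theta'$ is a well-typed list of declarations of its abstract methods $\Theta$ and public methods $\Theta'$, of definitions $m=\lambda x.M$ for the public methods, and of initialisations $r:=i$, $r:=\lambda x.M$ (the latter stores a fresh name bound to $\lambda x.M$). Its evaluation yields an initial $R_0,S_0$. **Traces.** An $N$-configuration consists of $N$ thread components, each an evaluation stack (of evaluation contexts and method names) with a term or $-$, and of $R$, $S$, sets $\mathcal P_{\mathcal L},\mathcal P_{\mathcal K}$ of public names and $\mathcal A_{\mathcal L},\mathcal A_{\mathcal K}$ of abstract names. Besides reductions of a thread's term, in which newly created names are fresh for the whole configuration, thread $t$ can make the transitions ($Y\in\{\mathcal K,\mathcal L\}$, values of matching types): $(t,\mathsf{call}\,m(v'))_{PY}$ from $(\mathcal E,E[mv])$ to $(m::E::\mathcal E,-)$, if $m\in\mathcal A_Y$; $(t,\mathsf{ret}\,m(v'))_{PY}$ from $(m::\mathcal E,v)$ to $(\mathcal E,-)$, if $m\in\mathcal P_Y$; $(t,\mathsf{call}\,m(v))_{OY}$ from $(\mathcal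 E,-)$ to $(m::\mathcal E,M\{v/x\})$, if $m\in\mathcal P_Y$ and $R(m)=\lambda x.M$; $(t,\mathsf{ret}\,m(v))_{OY}$ from $(m::E::\mathcal E,-)$ to $(\mathcal E,E[v])$, if $m\in\mathcal A_Y$. In $P$-moves, $v'$ is $v$ with its names $m_i$ replaced by distinct fresh names $m_i'$ of the same types, which are added to $\mathcal P_Y$ and bound to $\lambda x.m_ix$ in $R$. In $O$-moves, the names in $v$ must be fresh and are added to $\mathcal A_Y$. Here a name is fresh if it is outside $\mathcal P_{\mathcal L},\mathcal P_{\mathcal K},\mathcal A_{\mathcal L},\mathcal A_{\mathcal K}$ and $\mathrm{dom}(R)$. For $L:\Theta\to\Theta'$, $[\![L]\!]$ is the set of traces, for any $N>0$, of runs from the configuration with all components $([],-)$, $R_0$, $S_0$, $\mathcal P_{\mathcal K}=\Theta'$, $\mathcal A_{\mathcal L}=\Theta$, $\mathcal P_{\mathcal L}=\mathcal A_{\mathcal K}=\emptyset$ to one with all components $([],-)$ or $([],())$. Put $[\![L]\!]_{\sf enc}=[\![L]\!]\cap\mathcal H^{\sf enc}_{\Theta,\Theta'}$. **Enc-linearisability.**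 On $\mathcal H_{\Theta,\Theta'}$, let $\triangleleft_{PO}$ be the relation that swaps two adjacent moves of different threads of which the first is an $O$-move or the second a $P$-move, and $\diamond$ the relation that swaps two adjacent moves of different threads of which one has second index $\mathcal K$ and the other $\mathcal L$. $L:\Theta\to\Theta'$ *enc-linearises to* $A$ if $A\subseteq\mathcal H^{\sf seq}_{\Theta,\Theta'}\cap\mathcal H^{\sf enc}_{\Theta,\Theta'}$ and for every $h\in[\![L]\!]_{\sf enc}$ there is $h'\in A$ with $h\,(\triangleleft_{PO}\cup\diamond)^*\,h'$ ($h'$ is then sequential and encapsulated). **The library.** $L_{\sf mset2}:\{\mathit{foo}\}\to\{\mathit{count},\mathit{update},\mathit{update\_enc}\}$, with $\mathit{foo},\mathit{count},\mathit{update\_enc}:\mathsf{int}\to\mathsf{int}$ and $\mathit{update}:\mathsf{int}\times(\mathsf{int}\to\mathsf{int})\to\mathsf{int}$, has a lock (an integer reference, initially $0$), a reference $F$, initially $\lambda x.0$, and a private method $\mathit{upd\_r}$ (kept in a reference to methods): - $\mathit{count}=\lambda i.\,(!F)i$ - $\mathit{update}=\lambda (i,g).\,\mathit{upd\_r}(i,g,(!F)i)$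 - $\mathit{upd\_r}=\lambda(i,g,j).\ \mathsf{let}\ y=|g\,j|\ \mathsf{in}\ \mathsf{acquire};\ \mathsf{let}\ f={!F}\ \mathsf{in}\ \mathsf{if}\ j=f\,i\ \mathsf{then}\ (F:=\lambda x.\,\mathsf{if}\ x=i\ \mathsf{then}\ y\ \mathsf{else}\ f\,x;\ \mathsf{release};\ y)\ \mathsf{else}\ (\mathsf{release};\ \mathit{upd\_r}(i,g,f\,i))$ - $\mathit{update\_enc}=\lambda i.\ \mathsf{acquire};\ \mathsf{let}\ y=|\mathit{foo}((!F)i)|\ \mathsf{in}\ \mathsf{let}\ f={!F}\ \mathsf{in}\ F:=\lambda x.\,\mathsf{if}\ x=i\ \mathsf{then}\ y\ \mathsf{else}\ f\,x;\ \mathsf{release};\ y$ **The specification.** For a multiset $I$ of integers, $I(i)$ is the multiplicity of $i$ and $I[i\mapsto n]$ is $I$ with the multiplicity of $i$ set to $n$. Let $\Theta=\{\mathit{foo}\}$ and $\Theta'=\{\mathit{count},\mathit{update},\mathit{update\_enc}\}$. $A_{\sf mset2}$ is the set of histories that underlie a sequence $s$ of moves, each accompanied by a multiset of integers, such that the underlying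 history is in $\mathcal H^{\sf seq}_{\Theta,\Theta'}$; the multiset of the first move, if any, is empty; whenever a $P$-move is immediately followed in $s$ by an $O$-move, both carry the same multiset; and, for each $t$, the subsequence of thread $t$ is derivable from $\mathcal S$ in the grammar (for this $t$; indices that are not shown are $\mathcal K$) $$\begin{aligned} \mathcal S\to{}&\epsilon\ \mid\ (t,\mathsf{call}\,\mathit{count}(i),I)_{O}\,(t,\mathsf{ret}\,\mathit{count}(I(i)),I)_{P}\,\mathcal S\\ \mid{}&(t,\mathsf{call}\,\mathit{update}(i,m),I)_{O}\,\mathcal M^{i,j}_{I,J}\,(t,\mathsf{ret}\,\mathit{update}(|j|),J[i\mapsto|j|])_{P}\,\mathcal S\\ \mid{}&(t,\mathsf{call}\,\mathit{update\_enc}(i),I)_{O\mathcal K}(t,\mathsf{call}\,\mathit{foo}(I(i)),I)_{P\mathcal L}(t,\mathsf{ret}\,\mathit{foo}(j),I)_{O\mathcal L}(t,\mathsf{ret}\,\mathit{update\_enc}(|j|),I[i\mapsto|j|])_{P\mathcal K}\,\mathcal S\\ \mathcal M^{i,j}_{I,J}\to{}&(t,\mathsf{call}\,m(I(i)),I)_{P}\,\mathcal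 S\,(t,\mathsf{ret}\,m(j),J)_{O}\quad\text{if }I(i)=J(i)\\ \mathcal M^{i,j}_{I,J}\to{}&(t,\mathsf{call}\,m(I(i)),I)_{P}\,\mathcal S\,(t,\mathsf{ret}\,m(j'),J')_{O}\,\mathcal M^{i,j}_{J',J}\quad\text{if }I(i)\neq J'(i) \end{aligned}$$ where $m$ in $\mathcal M$ is the method name passed in the enclosing call of $\mathit{update}$. **Lemma (Parameterised multiset).** $L_{\sf mset2}$ enc-linearises to $A_{\sf mset2}$. -/

import Mathlib

namespace HOLin

/-! ### Types, names, values -/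

/-- Types: `θ ::= unit | int | θ × θ | θ → θ`. -/
inductive Ty where
  | unit : Ty
  | int : Ty
  | prod : Ty → Ty → Ty
  | arrow : Ty → Ty → Ty
  deriving DecidableEq

/-- Method names; there are countably many of each type `arg → res`. -/
structure Meth where
  arg : Ty
  res : Ty
  id : ℕ
  deriving DecidableEq

/-- Reference names: integer references and references to methods of type `θ → θ'`. -/
inductive Ref where
  | int : ℕ → Ref
  | fn : Ty → Ty → ℕ → Ref
  deriving DecidableEq

/-- Variables. -/
abbrev Var := ℕ

/-- Values: `v ::= () | i | m | ⟨v, v⟩`. -/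
inductive Val where
  | unit : Val
  | int : ℤ → Val
  | meth : Meth → Val
  | pair : Val → Val → Val
  deriving DecidableEq

/-- The type of a value. -/
def Val.ty : Val → Ty
  | .unit => .unit
  | .int _ => .int
  | .meth m => .arrow m.arg m.res
  | .pair v w => .prod v.ty w.ty

/-- The method names occurring in a value. -/
def Val.names : Val → Finset Meth
  | .unit => ∅
  | .int _ => ∅
  | .meth m => {m}
  | .pair v w => v.names ∪ w.names

/-- Renaming of the method names of a value. -/
def Val.rename (ρ : Meth → Meth) : Val → Val
  | .unit => .unit
  | .int i => .int i
  | .meth m => .meth (ρ m)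
  | .pair v w => .pair (v.rename ρ) (w.rename ρ)

/-! ### Moves and histories -/

/-- Proponent (the library) and Opponent (its environment). -/
inductive Player where
  | O : Player
  | P : Player
  deriving DecidableEq

/-- The other player. -/
def Player.opp : Player → Player
  | .O => .P
  | .P => .O

/-- The second polarity index: the client (`K`) or the parameter library (`L`). -/
inductive Side where
  | K : Side
  | L : Side
  deriving DecidableEq

/-- Calls and returns. -/
inductive Kind where
  | call : Kind
  | ret : Kind
  deriving DecidableEq

/-- `call m(v)` or `ret m(v)`, with polarity index `who side`. -/
structure Act where
  kind : Kind
  meth : Meth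
  val : Val
  who : Player
  side : Side
  deriving DecidableEq

/-- A move is an action decorated with a thread identifier. -/
structure Move where
  thread : ℕ
  act : Act
  deriving DecidableEq

/-- Prehistories starting with a move of `X`:
`H_X ::= ε | call m(v)_{XY} H_{X'} ret m(v')_{X'Y} H_X` where `X'` is the opponent of `X`. -/
inductive PreHist : Player → List Act → Prop where
  | nil (X : Player) : PreHist X []
  | call (X : Player) (Y : Side) (m : Meth) (v v' : Val) (h₁ h₂ : List Act) :
      v.ty = m.arg → v'.ty = m.res → PreHist X.opp h₁ → PreHist X h₂ →
      PreHist X (⟨.call, m, v, X, Y⟩ :: (h₁ ++ ⟨.ret, m, v', X.opp, Y⟩ :: h₂))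

/-- The actions of thread `t` in a sequence of moves. -/
def proj (h : List Move) (t : ℕ) : List Act :=
  (h.filter (fun x => x.thread = t)).map Move.act

/-- The method names occurring in a move. -/
def Move.names (x : Move) : Finset Meth := insert x.act.meth x.act.val.names

/-- The histories over `Θ → Θ'`: interleavings of Opponent-prehistories of threads `1, …, N`,
for some `N > 0`, that satisfy the call condition and the freshness condition. -/
structure IsHist (Θ Θ' : Finset Meth) (h : List Move) : Prop where
  threads : ∃ N : ℕ, 0 < N ∧ (∀ x ∈ h, 1 ≤ x.thread ∧ x.thread ≤ N) ∧
    ∀ t, 1 ≤ t → t ≤ N → PreHist .O (proj h t)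
  calls : ∀ (s₁ s₂ : List Move) (x : Move), h = s₁ ++ x :: s₂ → x.act.kind = .call →
    (x.act.meth ∈ Θ' ∧ x.act.who = .O ∧ x.act.side = .K) ∨
    (x.act.meth ∈ Θ ∧ x.act.who = .P ∧ x.act.side = .L) ∨
    ∃ y ∈ s₁, y.act.who ≠ x.act.who ∧ y.act.side = x.act.side ∧ x.act.meth ∈ y.act.val.names
  fresh : ∀ (s₁ s₂ : List Move) (x : Move), h = s₁ ++ x :: s₂ →
    ∀ m ∈ x.act.val.names, ∀ y ∈ s₁, m ∉ y.names

/-- The set of histories over `Θ → Θ'`. -/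
def Hist (Θ Θ' : Finset Meth) : Set (List Move) := {h | IsHist Θ Θ' h}

/-- Sequences `(t₁,x₁)_O (t₁,x₁')_P ⋯ (t_k,x_k)_O (t_k,x_k')_P`. -/
inductive Alternating : List Move → Prop where
  | nil : Alternating []
  | cons (t : ℕ) (x x' : Act) (s : List Move) : x.who = .O → x'.who = .P → Alternating s →
      Alternating (⟨t, x⟩ :: ⟨t, x'⟩ :: s)

/-- The sequential histories. -/
def HistSeq (Θ Θ' : Finset Meth) : Set (List Move) := {h | h ∈ Hist Θ Θ' ∧ Alternating h}

/-- Within a thread, Opponent does not switch between the client and the parameter library. -/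
def Encapsulated (h : List Move) : Prop :=
  ∀ (s₁ s₂ s₃ : List Move) (x y : Move),
    h = s₁ ++ x :: (s₂ ++ y :: s₃) → x.thread = y.thread → (∀ z ∈ s₂, z.thread ≠ x.thread) →
    x.act.who = .P → y.act.who = .O → x.act.side = y.act.side

/-- The encapsulated histories. -/
def HistEnc (Θ Θ' : Finset Meth) : Set (List Move) := {h | h ∈ Hist Θ Θ' ∧ Encapsulated h}

/-- The reordering relation `◁_{XX'}` on histories: two adjacent moves of different threads are
swapped so that an `X'`-move occurs later or an `X`-move occurs earlier. -/
inductive Swap (Θ Θ' : Finset Meth) (X X' : Player) : List Move → List Move → Prop where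
  | later (s₁ s₂ : List Move) (x x' : Move) : x'.thread ≠ x.thread → x'.act.who = X' →
      s₁ ++ x' :: x :: s₂ ∈ Hist Θ Θ' → s₁ ++ x :: x' :: s₂ ∈ Hist Θ Θ' →
      Swap Θ Θ' X X' (s₁ ++ x' :: x :: s₂) (s₁ ++ x :: x' :: s₂)
  | earlier (s₁ s₂ : List Move) (x x' : Move) : x'.thread ≠ x.thread → x.act.who = X →
      s₁ ++ x' :: x :: s₂ ∈ Hist Θ Θ' → s₁ ++ x :: x' :: s₂ ∈ Hist Θ Θ' →
      Swap Θ Θ' X X' (s₁ ++ x' :: x :: s₂) (s₁ ++ x :: x' :: s₂)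

/-- The relation `◇` on histories: two adjacent moves of different threads, one a client move and
the other a parameter-library move, are swapped. -/
inductive Diamond (Θ Θ' : Finset Meth) : List Move → List Move → Prop where
  | swap (s₁ s₂ : List Move) (x x' : Move) : x.thread ≠ x'.thread → x.act.side ≠ x'.act.side →
      s₁ ++ x :: x' :: s₂ ∈ Hist Θ Θ' → s₁ ++ x' :: x :: s₂ ∈ Hist Θ Θ' →
      Diamond Θ Θ' (s₁ ++ x :: x' :: s₂) (s₁ ++ x' :: x :: s₂)

/-- `h₁` is enc-linearised by `h₂`. -/
def EncLinBy (Θ Θ' : Finset Meth) (h₁ h₂ : List Move) : Prop :=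
  h₁ ∈ HistEnc Θ Θ' ∧ h₂ ∈ HistEnc Θ Θ' ∧
  Relation.ReflTransGen (fun a b => Swap Θ Θ' .P .O a b ∨ Diamond Θ Θ' a b) h₁ h₂ ∧
  h₂ ∈ HistSeq Θ Θ'

/-! ### Terms, blocks, libraries and their typing -/

/-- Binary arithmetic operations; comparisons return `1` or `0`. -/
inductive Op where
  | add : Op
  | sub : Op
  | mul : Op
  | eq : Op
  | lt : Op
  deriving DecidableEq

/-- The meaning of the arithmetic operations. -/
def Op.eval : Op → ℤ → ℤ → ℤ
  | .add, i, j => i + j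
  | .sub, i, j => i - j
  | .mul, i, j => i * j
  | .eq, i, j => if i = j then 1 else 0
  | .lt, i, j => if i < j then 1 else 0

/-- Terms. Applications are `x M` (`appVar`) and `m M` (`appMeth`); `acquire r` and `release r`
are the operations of the lock held in the integer reference `r` (`0` free, `1` taken). -/
inductive Tm where
  | unit : Tm
  | int : ℤ → Tm
  | tid : Tm
  | var : Var → Tm
  | meth : Meth → Tm
  | op : Op → Tm → Tm → Tm
  | ite : Tm → Tm → Tm → Tm
  | pair : Tm → Tm → Tm
  | fst : Tm → Tm
  | snd : Tm → Tm
  | lam : Var → Ty → Tm → Tm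
  | appVar : Var → Tm → Tm
  | appMeth : Meth → Tm → Tm
  | letin : Var → Tm → Tm → Tm
  | assign : Ref → Tm → Tm
  | deref : Ref → Tm
  | acquire : Ref → Tm
  | release : Ref → Tm

/-- Sequential composition `M; N`, with a variable that is not used elsewhere as the dummy. -/
def Tm.seq (M N : Tm) : Tm := .letin 1000 M N

/-- The method names occurring in a term. -/
def Tm.names : Tm → Finset Meth
  | .unit => ∅
  | .int _ => ∅
  | .tid => ∅
  | .var _ => ∅
  | .meth m => {m}
  | .op _ M N => M.names ∪ N.names
  | .ite M N N' => M.names ∪ N.names ∪ N'.names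
  | .pair M N => M.names ∪ N.names
  | .fst M => M.names
  | .snd M => M.names
  | .lam _ _ M => M.names
  | .appVar _ M => M.names
  | .appMeth m M => insert m M.names
  | .letin _ M N => M.names ∪ N.names
  | .assign _ M => M.names
  | .deref _ => ∅
  | .acquire _ => ∅
  | .release _ => ∅

/-- The type of the contents of a reference. -/
def Ref.ty : Ref → Ty
  | .int _ => .int
  | .fn θ θ' _ => .arrow θ θ'

/-- Typing environments. -/
abbrev TyEnv := Var → Option Ty

/-- The typing judgement `Γ ⊢ M : θ`. -/
inductive HasTy : TyEnv → Tm → Ty → Prop where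
  | unit (Γ : TyEnv) : HasTy Γ .unit .unit
  | int (Γ : TyEnv) (i : ℤ) : HasTy Γ (.int i) .int
  | tid (Γ : TyEnv) : HasTy Γ .tid .int
  | var (Γ : TyEnv) (x : Var) (θ : Ty) : Γ x = some θ → HasTy Γ (.var x) θ
  | meth (Γ : TyEnv) (m : Meth) : HasTy Γ (.meth m) (.arrow m.arg m.res)
  | op (Γ : TyEnv) (o : Op) (M N : Tm) : HasTy Γ M .int → HasTy Γ N .int →
      HasTy Γ (.op o M N) .int
  | ite (Γ : TyEnv) (M N N' : Tm) (θ : Ty) : HasTy Γ M .int → HasTy Γ N θ → HasTy Γ N' θ →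
      HasTy Γ (.ite M N N') θ
  | pair (Γ : TyEnv) (M N : Tm) (θ θ' : Ty) : HasTy Γ M θ → HasTy Γ N θ' →
      HasTy Γ (.pair M N) (.prod θ θ')
  | fst (Γ : TyEnv) (M : Tm) (θ θ' : Ty) : HasTy Γ M (.prod θ θ') → HasTy Γ (.fst M) θ
  | snd (Γ : TyEnv) (M : Tm) (θ θ' : Ty) : HasTy Γ M (.prod θ θ') → HasTy Γ (.snd M) θ'
  | lam (Γ : TyEnv) (x : Var) (M : Tm) (θ θ' : Ty) :
      HasTy (Function.update Γ x (some θ)) M θ' → HasTy Γ (.lam x θ M) (.arrow θ θ')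
  | appVar (Γ : TyEnv) (x : Var) (M : Tm) (θ θ' : Ty) : Γ x = some (.arrow θ θ') →
      HasTy Γ M θ → HasTy Γ (.appVar x M) θ'
  | appMeth (Γ : TyEnv) (m : Meth) (M : Tm) : HasTy Γ M m.arg → HasTy Γ (.appMeth m M) m.res
  | letin (Γ : TyEnv) (x : Var) (M N : Tm) (θ θ' : Ty) : HasTy Γ M θ →
      HasTy (Function.update Γ x (some θ)) N θ' → HasTy Γ (.letin x M N) θ'
  | assign (Γ : TyEnv) (r : Ref) (M : Tm) : HasTy Γ M r.ty → HasTy Γ (.assign r M) .unit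
  | deref (Γ : TyEnv) (r : Ref) : HasTy Γ (.deref r) r.ty
  | acquire (Γ : TyEnv) (n : ℕ) : HasTy Γ (.acquire (.int n)) .unit
  | release (Γ : TyEnv) (n : ℕ) : HasTy Γ (.release (.int n)) .unit

/-- Blocks: method definitions `m = λx.M` and reference initialisations `r := λx.M`, `r := i`. -/
inductive Block where
  | nil : Block
  | meth : Meth → Var → Tm → Block → Block
  | refFn : Ref → Var → Tm → Block → Block
  | refInt : Ref → ℤ → Block → Block

/-- The method names occurring in a block. -/
def Block.names : Block → Finset Meth
  | .nil => ∅
  | .meth m _ M B => insert m (M.names ∪ B.names)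
  | .refFn _ _ M B => M.names ∪ B.names
  | .refInt _ _ B => B.names

/-- Libraries: declarations of abstract and public methods followed by a block. -/
inductive Lib where
  | block : Block → Lib
  | abs : Meth → Lib → Lib
  | pub : Meth → Lib → Lib

/-- The method names occurring in a library. -/
def Lib.names : Lib → Finset Meth
  | .block B => B.names
  | .abs m L => insert m L.names
  | .pub m L => insert m L.names

/-- The environment with the single declaration `x : θ`. -/
def single (x : Var) (θ : Ty) : TyEnv := Function.update (fun _ => none) x (some θ)

/-- Typing of blocks; the second argument collects the defined methods. -/
inductive BlockTy : Block → Finset Meth → Prop where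
  | nil : BlockTy .nil ∅
  | meth (m : Meth) (x : Var) (M : Tm) (B : Block) (Θ : Finset Meth) :
      HasTy (single x m.arg) M m.res → BlockTy B Θ → m ∉ Θ →
      BlockTy (.meth m x M B) (insert m Θ)
  | refFn (θ θ' : Ty) (n : ℕ) (x : Var) (M : Tm) (B : Block) (Θ : Finset Meth) :
      HasTy (single x θ) M θ' → BlockTy B Θ → BlockTy (.refFn (.fn θ θ' n) x M B) Θ
  | refInt (n : ℕ) (i : ℤ) (B : Block) (Θ : Finset Meth) :
      BlockTy B Θ → BlockTy (.refInt (.int n) i B) Θ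

/-- The typing judgement `Ξ ⊢ L : Θ → Θ'` for libraries. -/
inductive LibTy : Finset Meth → Lib → Finset Meth → Finset Meth → Prop where
  | block (B : Block) (Θ' : Finset Meth) : BlockTy B Θ' → LibTy B.names (.block B) ∅ Θ'
  | pub (Ξ : Finset Meth) (m : Meth) (L : Lib) (Θ Θ' : Finset Meth) : m ∉ Ξ →
      LibTy (insert m Ξ) L Θ Θ' → m ∈ Θ' → LibTy Ξ (.pub m L) Θ Θ'
  | abs (Ξ : Finset Meth) (m : Meth) (L : Lib) (Θ Θ' : Finset Meth) : m ∉ Ξ →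
      LibTy (insert m Ξ) L Θ Θ' → m ∉ Θ' → m ∉ Θ → LibTy Ξ (.abs m L) (insert m Θ) Θ'

/-! ### Operational semantics -/

/-- Repositories: partial maps from method names to `λx.M`, given as the pair `(x, M)`. -/
abbrev Repo := Meth → Option (Var × Tm)

/-- Stores: partial maps from references to integers and method names. -/
abbrev Store := Ref → Option Val

/-- A value as a term. -/
def Val.toTm : Val → Tm
  | .unit => .unit
  | .int i => .int i
  | .meth m => .meth m
  | .pair v w => .pair v.toTm w.toTm

/-- The application `v M`, where `v` has just been substituted for the variable `x` in `x M`. -/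
def applyVal (x : Var) : Val → Tm → Tm
  | .meth m, M => .appMeth m M
  | _, M => .appVar x M

/-- Substitution `M{v/x}` of a (closed) value. -/
def Tm.subst (x : Var) (v : Val) : Tm → Tm
  | .unit => .unit
  | .int i => .int i
  | .tid => .tid
  | .var y => if y = x then v.toTm else .var y
  | .meth m => .meth m
  | .op o M N => .op o (M.subst x v) (N.subst x v)
  | .ite M N N' => .ite (M.subst x v) (N.subst x v) (N'.subst x v)
  | .pair M N => .pair (M.subst x v) (N.subst x v)
  | .fst M => .fst (M.subst x v)
  | .snd M => .snd (M.subst x v)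
  | .lam y θ M => if y = x then .lam y θ M else .lam y θ (M.subst x v)
  | .appVar y M => if y = x then applyVal x v (M.subst x v) else .appVar y (M.subst x v)
  | .appMeth m M => .appMeth m (M.subst x v)
  | .letin y M N => .letin y (M.subst x v) (if y = x then N else N.subst x v)
  | .assign r M => .assign r (M.subst x v)
  | .deref r => .deref r
  | .acquire r => .acquire r
  | .release r => .release r

/-- Evaluation contexts. -/
inductive ECtx where
  | hole : ECtx
  | opL : Op → ECtx → Tm → ECtx
  | opR : Op → ℤ → ECtx → ECtx
  | ite : ECtx → Tm → Tm → ECtx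
  | fst : ECtx → ECtx
  | snd : ECtx → ECtx
  | pairL : ECtx → Tm → ECtx
  | pairR : Val → ECtx → ECtx
  | appMeth : Meth → ECtx → ECtx
  | letin : Var → ECtx → Tm → ECtx
  | assign : Ref → ECtx → ECtx

/-- `E[M]`. -/
def ECtx.plug : ECtx → Tm → Tm
  | .hole, M => M
  | .opL o E N, M => .op o (E.plug M) N
  | .opR o i E, M => .op o (.int i) (E.plug M)
  | .ite E N N', M => .ite (E.plug M) N N'
  | .fst E, M => .fst (E.plug M)
  | .snd E, M => .snd (E.plug M)
  | .pairL E N, M => .pair (E.plug M) N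
  | .pairR v E, M => .pair v.toTm (E.plug M)
  | .appMeth m E, M => .appMeth m (E.plug M)
  | .letin x E N, M => .letin x (E.plug M) N
  | .assign r E, M => .assign r (E.plug M)

/-- The method names occurring in an evaluation context. -/
def ECtx.names : ECtx → Finset Meth
  | .hole => ∅
  | .opL _ E N => E.names ∪ N.names
  | .opR _ _ E => E.names
  | .ite E N N' => E.names ∪ N.names ∪ N'.names
  | .fst E => E.names
  | .snd E => E.names
  | .pairL E N => E.names ∪ N.names
  | .pairR v E => v.names ∪ E.names
  | .appMeth m E => insert m E.names
  | .letin _ E N => E.names ∪ N.names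
  | .assign _ E => E.names

/-- Library evaluation. The names chosen for the functions stored in references are fresh: outside
the repository and outside the set `Z` of names of the library. -/
inductive LibStep (Z : Finset Meth) : Lib × Repo × Store → Lib × Repo × Store → Prop where
  | abs (m : Meth) (L : Lib) (R : Repo) (S : Store) : LibStep Z (.abs m L, R, S) (L, R, S)
  | pub (m : Meth) (L : Lib) (R : Repo) (S : Store) : LibStep Z (.pub m L, R, S) (L, R, S)
  | refInt (r : Ref) (i : ℤ) (B : Block) (R : Repo) (S : Store) :
      LibStep Z (.block (.refInt r i B), R, S)
        (.block B, R, Function.update S r (some (.int i)))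
  | meth (m : Meth) (x : Var) (M : Tm) (B : Block) (R : Repo) (S : Store) : R m = none →
      LibStep Z (.block (.meth m x M B), R, S)
        (.block B, Function.update R m (some (x, M)), S)
  | refFn (θ θ' : Ty) (n : ℕ) (x : Var) (M : Tm) (B : Block) (R : Repo) (S : Store) (m : Meth) :
      m.arg = θ → m.res = θ' → R m = none → m ∉ Z →
      LibStep Z (.block (.refFn (.fn θ θ' n) x M B), R, S)
        (.block B, Function.update R m (some (x, M)),
          Function.update S (.fn θ θ' n) (some (.meth m)))

/-- The library `L` evaluates to the initial repository `R₀` and the initial store `S₀`. -/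
def Lib.Evaluates (L : Lib) (R₀ : Repo) (S₀ : Store) : Prop :=
  Relation.ReflTransGen (LibStep L.names) (L, (fun _ => none), (fun _ => none))
    (.block .nil, R₀, S₀)

/-- Reduction of terms in thread `t`. -/
inductive TStep (t : ℕ) : Tm × Repo × Store → Tm × Repo × Store → Prop where
  | tid (E : ECtx) (R : Repo) (S : Store) : TStep t (E.plug .tid, R, S) (E.plug (.int t), R, S)
  | op (E : ECtx) (R : Repo) (S : Store) (o : Op) (i j : ℤ) :
      TStep t (E.plug (.op o (.int i) (.int j)), R, S) (E.plug (.int (o.eval i j)), R, S)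
  | deref (E : ECtx) (R : Repo) (S : Store) (r : Ref) (v : Val) : S r = some v →
      TStep t (E.plug (.deref r), R, S) (E.plug v.toTm, R, S)
  | iteZero (E : ECtx) (R : Repo) (S : Store) (M₁ M₀ : Tm) :
      TStep t (E.plug (.ite (.int 0) M₁ M₀), R, S) (E.plug M₀, R, S)
  | iteNonzero (E : ECtx) (R : Repo) (S : Store) (i : ℤ) (M₁ M₀ : Tm) : i ≠ 0 →
      TStep t (E.plug (.ite (.int i) M₁ M₀), R, S) (E.plug M₁, R, S)
  | assign (E : ECtx) (R : Repo) (S : Store) (r : Ref) (v : Val) :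
      TStep t (E.plug (.assign r v.toTm), R, S)
        (E.plug .unit, R, Function.update S r (some v))
  | lam (E : ECtx) (R : Repo) (S : Store) (x : Var) (θ : Ty) (M : Tm) (m : Meth) :
      HasTy (fun _ => none) (.lam x θ M) (.arrow m.arg m.res) → R m = none →
      TStep t (E.plug (.lam x θ M), R, S)
        (E.plug (.meth m), Function.update R m (some (x, M)), S)
  | app (E : ECtx) (R : Repo) (S : Store) (m : Meth) (v : Val) (x : Var) (M : Tm) :
      R m = some (x, M) →
      TStep t (E.plug (.appMeth m v.toTm), R, S) (E.plug (M.subst x v), R, S)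
  | fst (E : ECtx) (R : Repo) (S : Store) (v w : Val) :
      TStep t (E.plug (.fst (.pair v.toTm w.toTm)), R, S) (E.plug v.toTm, R, S)
  | snd (E : ECtx) (R : Repo) (S : Store) (v w : Val) :
      TStep t (E.plug (.snd (.pair v.toTm w.toTm)), R, S) (E.plug w.toTm, R, S)
  | letin (E : ECtx) (R : Repo) (S : Store) (x : Var) (v : Val) (M : Tm) :
      TStep t (E.plug (.letin x v.toTm M), R, S) (E.plug (M.subst x v), R, S)
  | acquire (E : ECtx) (R : Repo) (S : Store) (r : Ref) : S r = some (.int 0) →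
      TStep t (E.plug (.acquire r), R, S)
        (E.plug .unit, R, Function.update S r (some (.int 1)))
  | release (E : ECtx) (R : Repo) (S : Store) (r : Ref) :
      TStep t (E.plug (.release r), R, S)
        (E.plug .unit, R, Function.update S r (some (.int 0)))

/-! ### Trace semantics -/

/-- Elements of evaluation stacks: evaluation contexts and method names. -/
inductive Item where
  | ctx : ECtx → Item
  | meth : Meth → Item

/-- The method names occurring in a stack element. -/
def Item.names : Item → Finset Meth
  | .ctx E => E.names
  | .meth m => {m}

/-- The component of one thread: its evaluation stack, and a term (Proponent configurations) or
nothing (Opponent configurations). -/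
structure Comp where
  stack : List Item
  ctrl : Option Tm

/-- `m` occurs in a thread component. -/
def Comp.Mentions (C : Comp) (m : Meth) : Prop :=
  (∃ I ∈ C.stack, m ∈ I.names) ∨ ∃ M ∈ C.ctrl, m ∈ M.names

/-- The components of a configuration that are shared by all threads: the repository, the public
names, the abstract names and the store. -/
structure Env where
  R : Repo
  P : Side → Set Meth
  A : Side → Set Meth
  S : Store

/-- `𝒫 ∪_Y Z`. -/
def addNames (Q : Side → Set Meth) (Y : Side) (Z : Set Meth) : Side → Set Meth :=
  Function.update Q Y (Q Y ∪ Z)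

/-- `m` is fresh: it is neither a public nor an abstract name, nor a private name of the
library. -/
def Env.Fresh (e : Env) (m : Meth) : Prop :=
  (∀ Y, m ∉ e.P Y) ∧ (∀ Y, m ∉ e.A Y) ∧ e.R m = none

/-- Proponent passes the value `v` to the side `Y` of the environment: each name `m` in `v` is
replaced by a fresh name `ρ m` of the same type, which is bound to `λx. m x` and becomes public;
`v'` is the value that is sent and `e'` the resulting environment. -/
def PassOut (Y : Side) (e : Env) (v v' : Val) (e' : Env) : Prop :=
  ∃ ρ : Meth → Meth,
    Set.InjOn ρ (v.names : Set Meth) ∧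
    (∀ m ∈ v.names, (ρ m).arg = m.arg ∧ (ρ m).res = m.res ∧ e.Fresh (ρ m)) ∧
    v' = v.rename ρ ∧
    (∀ m ∈ v.names, e'.R (ρ m) = some (0, .appMeth m (.var 0))) ∧
    (∀ n, (∀ m ∈ v.names, n ≠ ρ m) → e'.R n = e.R n) ∧
    e'.P = addNames e.P Y (ρ '' (v.names : Set Meth)) ∧ e'.A = e.A ∧ e'.S = e.S

/-- Opponent passes the value `v` from the side `Y` of the environment: the names in `v` are fresh
and become abstract. -/
def PassIn (Y : Side) (e : Env) (v : Val) (e' : Env) : Prop :=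
  (∀ m ∈ v.names, e.Fresh m) ∧ e' = { e with A := addNames e.A Y (v.names : Set Meth) }

/-- The internal transitions of thread `t`. -/
inductive IntStep (t : ℕ) : Comp → Env → Comp → Env → Prop where
  | int (𝓔 : List Item) (e : Env) (M M' : Tm) (R' : Repo) (S' : Store) :
      TStep t (M, e.R, e.S) (M', R', S') →
      (∀ m, e.R m = none → R' m ≠ none →
        (∀ I ∈ 𝓔, m ∉ I.names) ∧ ∀ Y, m ∉ e.A Y) →
      IntStep t ⟨𝓔, some M⟩ e ⟨𝓔, some M'⟩ { e with R := R', S := S' }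

/-- The external transitions of a thread: Proponent calls and returns, Opponent calls and
returns. -/
inductive ExtStep : Act → Comp → Env → Comp → Env → Prop where
  | pCall (Y : Side) (𝓔 : List Item) (E : ECtx) (m : Meth) (v v' : Val) (e e' : Env) :
      m ∈ e.A Y → v'.ty = m.arg → PassOut Y e v v' e' →
      ExtStep ⟨.call, m, v', .P, Y⟩ ⟨𝓔, some (E.plug (.appMeth m v.toTm))⟩ e
        ⟨.meth m :: .ctx E :: 𝓔, none⟩ e'
  | pRet (Y : Side) (𝓔 : List Item) (m : Meth) (v v' : Val) (e e' : Env) :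
      m ∈ e.P Y → v'.ty = m.res → PassOut Y e v v' e' →
      ExtStep ⟨.ret, m, v', .P, Y⟩ ⟨.meth m :: 𝓔, some v.toTm⟩ e ⟨𝓔, none⟩ e'
  | oCall (Y : Side) (𝓔 : List Item) (m : Meth) (v : Val) (x : Var) (M : Tm) (e e' : Env) :
      m ∈ e.P Y → v.ty = m.arg → e.R m = some (x, M) → PassIn Y e v e' →
      ExtStep ⟨.call, m, v, .O, Y⟩ ⟨𝓔, none⟩ e ⟨.meth m :: 𝓔, some (M.subst x v)⟩ e'
  | oRet (Y : Side) (𝓔 : List Item) (E : ECtx) (m : Meth) (v : Val) (e e' : Env) :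
      m ∈ e.A Y → v.ty = m.res → PassIn Y e v e' →
      ExtStep ⟨.ret, m, v, .O, Y⟩ ⟨.meth m :: .ctx E :: 𝓔, none⟩ e
        ⟨𝓔, some (E.plug v.toTm)⟩ e'

/-- Runs of `N`-configurations, whose threads are numbered `1, …, N`, with their traces. In an
internal step, newly created names are fresh for the components of all threads. -/
inductive Run {N : ℕ} : (Fin N → Comp) → Env → List Move → (Fin N → Comp) → Env → Prop where
  | refl (C : Fin N → Comp) (e : Env) : Run C e [] C e
  | int (C : Fin N → Comp) (e : Env) (i : Fin N) (D : Comp) (e₁ : Env) (s : List Move)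
      (C' : Fin N → Comp) (e' : Env) :
      IntStep ((i : ℕ) + 1) (C i) e D e₁ →
      (∀ m, e.R m = none → e₁.R m ≠ none → ∀ j, ¬ (C j).Mentions m) →
      Run (Function.update C i D) e₁ s C' e' → Run C e s C' e'
  | ext (C : Fin N → Comp) (e : Env) (i : Fin N) (a : Act) (D : Comp) (e₁ : Env)
      (s : List Move) (C' : Fin N → Comp) (e' : Env) :
      ExtStep a (C i) e D e₁ →
      Run (Function.update C i D) e₁ s C' e' → Run C e (⟨(i : ℕ) + 1, a⟩ :: s) C' e'

/-- Final thread components: `([], -)` and `([], ())`. -/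
def Comp.Final (C : Comp) : Prop := C = ⟨[], none⟩ ∨ C = ⟨[], some .unit⟩

/-- The pair of name sets with `Z` on the side `Y` and nothing on the other side. -/
def onlyOn (Y : Side) (Z : Finset Meth) : Side → Set Meth :=
  addNames (fun _ => ∅) Y (Z : Set Meth)

/-- The `N`-trace semantics of a library `L : Θ → Θ'`. -/
def semN (N : ℕ) (Θ Θ' : Finset Meth) (L : Lib) : Set (List Move) :=
  {s | ∃ (R₀ : Repo) (S₀ : Store) (C : Fin N → Comp) (e : Env), L.Evaluates R₀ S₀ ∧
    Run (fun _ => ⟨[], none⟩) ⟨R₀, onlyOn .K Θ', onlyOn .L Θ, S₀⟩ s C e ∧ ∀ i, (C i).Final}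

/-- The trace semantics of a library `L : Θ → Θ'`, for any positive number of threads. -/
def sem (Θ Θ' : Finset Meth) (L : Lib) : Set (List Move) := {s | ∃ N, 0 < N ∧ s ∈ semN N Θ Θ' L}

/-- The encapsulated traces of `L`. -/
def semEnc (Θ Θ' : Finset Meth) (L : Lib) : Set (List Move) := sem Θ Θ' L ∩ HistEnc Θ Θ'

/-- The library `L : Θ → Θ'` enc-linearises to `A`. -/
def EncLinearises (Θ Θ' : Finset Meth) (L : Lib) (A : Set (List Move)) : Prop :=
  LibTy ∅ L Θ Θ' ∧ A ⊆ HistSeq Θ Θ' ∩ HistEnc Θ Θ' ∧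
  ∀ h ∈ semEnc Θ Θ' L, ∃ h' ∈ A, EncLinBy Θ Θ' h h'

/-! ### The parameterised multiset library -/

/-- `count : int → int`. -/
def count : Meth := ⟨.int, .int, 0⟩

/-- `update : int × (int → int) → int`. -/
def update : Meth := ⟨.prod .int (.arrow .int .int), .int, 0⟩

/-- `update_enc : int → int`. -/
def updateEnc : Meth := ⟨.int, .int, 1⟩

/-- `foo : int → int`. -/
def foo : Meth := ⟨.int, .int, 2⟩

/-- The lock. -/
def lockRef : Ref := .int 0

/-- The reference `F`, which holds the characteristic function of the multiset. -/
def refF : Ref := .fn .int .int 0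

/-- The reference that holds the private method `upd_r`, whose argument is `(i, (g, j))`. -/
def updR : Ref := .fn (.prod .int (.prod (.arrow .int .int) .int)) .int 0

/-- The variable `x`. -/
abbrev vx : Var := 0
/-- The variable `i`. -/
abbrev vi : Var := 1
/-- The variable `g`. -/
abbrev vg : Var := 2
/-- The variable `j`. -/
abbrev vj : Var := 3
/-- The variable `y`. -/
abbrev vy : Var := 4
/-- The variable `f`. -/
abbrev vf : Var := 5
/-- A variable for the tuple of arguments. -/
abbrev vp : Var := 6
/-- An auxiliary variable of the absolute value. -/
abbrev vz : Var := 7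
/-- A variable for the contents of `updR`. -/
abbrev vu : Var := 8

/-- `|M|`, as `let z = M in if z < 0 then 0 - z else z`. -/
def absTm (M : Tm) : Tm :=
  .letin vz M (.ite (.op .lt (.var vz) (.int 0)) (.op .sub (.int 0) (.var vz)) (.var vz))

/-- `(!F) i`. -/
def lookup : Tm := .letin vf (.deref refF) (.appVar vf (.var vi))

/-- `F := λx. if (x == i) then y else f x`. -/
def writeF : Tm :=
  .assign refF (.lam vx .int
    (.ite (.op .eq (.var vx) (.var vi)) (.var vy) (.appVar vf (.var vx))))

/-- `upd_r (i, g, M)`. -/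
def callUpdR (M : Tm) : Tm :=
  .letin vu (.deref updR) (.appVar vu (.pair (.var vi) (.pair (.var vg) M)))

/-- The body of `count = λi. (!F) i`. -/
def countBody : Tm := lookup

/-- The body of `update = λ(i, g). upd_r (i, g, (!F) i)`. -/
def updateBody : Tm :=
  .letin vi (.fst (.var vp)) (.letin vg (.snd (.var vp)) (callUpdR lookup))

/-- The body of `upd_r = λ(i, g, j). …`: `let y = |g j| in lock.acquire(); let f = !F in
if (j == f i) then { F := …; lock.release(); y } else { lock.release(); upd_r (i, g, f i) }`. -/
def updRBody : Tm :=
  .letin vi (.fst (.var vp)) <|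
  .letin vg (.fst (.snd (.var vp))) <|
  .letin vj (.snd (.snd (.var vp))) <|
  .letin vy (absTm (.appVar vg (.var vj))) <|
  .seq (.acquire lockRef) <|
  .letin vf (.deref refF) <|
  .ite (.op .eq (.var vj) (.appVar vf (.var vi)))
    (.seq writeF (.seq (.release lockRef) (.var vy)))
    (.seq (.release lockRef) (callUpdR (.appVar vf (.var vi))))

/-- The body of `update_enc = λi. …`: `lock.acquire(); let y = |foo ((!F) i)| in let f = !F in
F := …; lock.release(); y`. -/
def updateEncBody : Tm :=
  .seq (.acquire lockRef) <|
  .letin vy (absTm (.appMeth foo lookup)) <|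
  .letin vf (.deref refF) <|
  .seq writeF (.seq (.release lockRef) (.var vy))

/-- The parameterised multiset library. -/
def Lmset2 : Lib :=
  .pub count <| .pub update <| .pub updateEnc <| .abs foo <| .block <|
  .refInt lockRef 0 <|
  .refFn refF vx (.int 0) <|
  .meth count vi countBody <|
  .meth update vp updateBody <|
  .refFn updR vp updRBody <|
  .meth updateEnc vi updateEncBody <|
  .nil

/-- The abstract methods of the library. -/
def absMeths : Finset Meth := {foo}

/-- The public methods of the library. -/
def pubMeths : Finset Meth := {count, update, updateEnc}

/-! ### The specification -/

/-- Moves of extended histories: moves accompanied by a multiset of integers. -/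
abbrev XMove := Move × Multiset ℤ

/-- `I[i ↦ n]`: the multiset `I` with the multiplicity of `i` set to `n`. -/
def setMult (I : Multiset ℤ) (i : ℤ) (n : ℕ) : Multiset ℤ :=
  I.filter (fun k => k ≠ i) + Multiset.replicate n i

/-- `(t, call m(v), I)_{XY}`. -/
def xcall (t : ℕ) (m : Meth) (v : Val) (X : Player) (Y : Side) (I : Multiset ℤ) : XMove :=
  (⟨t, ⟨.call, m, v, X, Y⟩⟩, I)

/-- `(t, ret m(v), I)_{XY}`. -/
def xret (t : ℕ) (m : Meth) (v : Val) (X : Player) (Y : Side) (I : Multiset ℤ) : XMove :=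
  (⟨t, ⟨.ret, m, v, X, Y⟩⟩, I)

mutual

/-- The grammar `𝒮` of the extended histories of a single thread `t`. -/
inductive SpecS (t : ℕ) : List XMove → Prop where
  | nil : SpecS t []
  | count (i : ℤ) (I : Multiset ℤ) (s : List XMove) : SpecS t s →
      SpecS t (xcall t count (.int i) .O .K I ::
        xret t count (.int (I.count i)) .P .K I :: s)
  | update (i j : ℤ) (m : Meth) (I J : Multiset ℤ) (w s : List XMove) :
      SpecM t m i j I J w → SpecS t s →
      SpecS t (xcall t update (.pair (.int i) (.meth m)) .O .K I :: (w ++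
        xret t update (.int |j|) .P .K (setMult J i j.natAbs) :: s))
  | updateEnc (i j : ℤ) (I : Multiset ℤ) (s : List XMove) : SpecS t s →
      SpecS t (xcall t updateEnc (.int i) .O .K I ::
        xcall t foo (.int (I.count i)) .P .L I ::
        xret t foo (.int j) .O .L I ::
        xret t updateEnc (.int |j|) .P .K (setMult I i j.natAbs) :: s)

/-- The grammar `ℳ` of the calls of `m` that are issued for a single call of `update`. -/
inductive SpecM (t : ℕ) : Meth → ℤ → ℤ → Multiset ℤ → Multiset ℤ → List XMove → Prop where
  | done (m : Meth) (i j : ℤ) (I J : Multiset ℤ) (s : List XMove) :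
      SpecS t s → I.count i = J.count i →
      SpecM t m i j I J (xcall t m (.int (I.count i)) .P .K I :: (s ++
        [xret t m (.int j) .O .K J]))
  | retry (m : Meth) (i j j' : ℤ) (I J' J : Multiset ℤ) (s w : List XMove) :
      SpecS t s → I.count i ≠ J'.count i → SpecM t m i j J' J w →
      SpecM t m i j I J (xcall t m (.int (I.count i)) .P .K I :: (s ++
        xret t m (.int j') .O .K J' :: w))

end

/-- The extended histories of the specification: the underlying history is sequential, the multiset
is empty at the start, Opponent moves do not change it, and each thread follows the grammar. -/
structure SpecExt (s : List XMove) : Prop where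
  seq : s.map Prod.fst ∈ HistSeq absMeths pubMeths
  start : ∀ (x : XMove) (s' : List XMove), s = x :: s' → x.2 = 0
  opponent : ∀ (s₁ s₂ : List XMove) (x y : XMove), s = s₁ ++ x :: y :: s₂ →
    x.1.act.who = .P → y.1.act.who = .O → x.2 = y.2
  thread : ∀ t, SpecS t (s.filter (fun x => x.1.thread = t))

/-- The specification of the parameterised multiset library. -/
def Amset2 : Set (List Move) := {h | ∃ s : List XMove, SpecExt s ∧ h = s.map Prod.fst}

end HOLin

/-!
A run of the library is simulated by a linearisation that grows with it. Every maximal segment of a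
thread's evaluation between an `O`-move and the next `P`-move contains exactly one linearisation
point: for `count`, for the first call of the argument of `update`, for a failed comparison in
`upd_r` and for the call of `foo` it is the dereference of `F`; for a successful comparison in
`upd_r` and for the end of `update_enc` it is the assignment to `F`. At this point the `O`-move and
the `P`-move are appended to the linearisation as a pair, accompanied by the multiset that `F`
represents before and after the point. The lock ensures that `F` does not change between the read
and the write of a critical section; since `update_enc` holds it during the call of `foo`, the
multiset is the same at the return of `foo` as at its call.

Let `h` be the trace so far, `pP` the `P`-moves that are linearised and not yet played, and `pO` the
`O`-moves that are played and not yet linearised. Then `h ++ pP` is reordered to the linearisation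
followed by `pO` by making `O`-moves later and `P`-moves earlier (`RunInv.reorders`); every
transition preserves this (`RunInv.intStep`, `RunInv.extStep`). At the end `pO` and `pP` are empty,
so the trace itself is reordered to the linearisation (`RunInv.run`). The swaps stay within the set
of histories, because names are not shared between threads (`threadLocal_of_specS`), so that being a
history depends only on the moves of the single threads (`IsHist.of_ofThread_eq`).

A thread is described by the invariant `ThreadInv`. Reductions that do not involve `F` or the
lock are deterministic (`DetSteps`), including the evaluation of the contents of `F`, which are
immutable closures. So only the states in which the next transition involves the shared state
have to be listed (`Stuck`); any other state evaluates deterministically to one of these. Along with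
its state, a thread keeps a word of the grammar with as many unanswered calls of arguments of
`update` as there are on its stack (`Partial`). Encapsulation is used once: it excludes client calls
by a thread that waits for the return of `foo`.
-/

namespace HOLin

/-! ### Unique decomposition of terms -/

/-- The value that a term is, if it is one. -/
def Tm.toVal? : Tm → Option Val
  | .unit => some .unit
  | .int i => some (.int i)
  | .meth m => some (.meth m)
  | .pair M N =>
    match M.toVal?, N.toVal? with
    | some v, some w => some (.pair v w)
    | _, _ => none
  | _ => none

/-- The decomposition of a term into an evaluation context and the subterm that is evaluated next.
For values, and for terms that are stuck for reasons of typing, it is undefined. -/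
def Tm.decomp : Tm → Option (ECtx × Tm)
  | .op o M N =>
    match M.toVal? with
    | none => M.decomp.map fun p => (.opL o p.1 N, p.2)
    | some (.int i) =>
      match N.toVal? with
      | none => N.decomp.map fun p => (.opR o i p.1, p.2)
      | some _ => some (.hole, .op o M N)
    | some _ => none
  | .ite M N N' =>
    match M.toVal? with
    | none => M.decomp.map fun p => (.ite p.1 N N', p.2)
    | some _ => some (.hole, .ite M N N')
  | .pair M N =>
    match M.toVal? with
    | none => M.decomp.map fun p => (.pairL p.1 N, p.2)
    | some v =>
      match N.toVal? with
      | none => N.decomp.map fun p => (.pairR v p.1, p.2)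
      | some _ => none
  | .fst M =>
    match M.toVal? with
    | none => M.decomp.map fun p => (.fst p.1, p.2)
    | some _ => some (.hole, .fst M)
  | .snd M =>
    match M.toVal? with
    | none => M.decomp.map fun p => (.snd p.1, p.2)
    | some _ => some (.hole, .snd M)
  | .appMeth m M =>
    match M.toVal? with
    | none => M.decomp.map fun p => (.appMeth m p.1, p.2)
    | some _ => some (.hole, .appMeth m M)
  | .letin x M N =>
    match M.toVal? with
    | none => M.decomp.map fun p => (.letin x p.1 N, p.2)
    | some _ => some (.hole, .letin x M N)
  | .assign r M =>
    match M.toVal? with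
    | none => M.decomp.map fun p => (.assign r p.1, p.2)
    | some _ => some (.hole, .assign r M)
  | .tid => some (.hole, .tid)
  | .deref r => some (.hole, .deref r)
  | .lam x θ M => some (.hole, .lam x θ M)
  | .acquire r => some (.hole, .acquire r)
  | .release r => some (.hole, .release r)
  | _ => none

@[simp] theorem Val.toVal?_toTm (v : Val) : v.toTm.toVal? = some v := by
  induction v with
  | pair v w hv hw => simp [Val.toTm, Tm.toVal?, hv, hw]
  | _ => simp [Val.toTm, Tm.toVal?]

theorem Tm.decomp_eq_none_of_toVal? {M : Tm} {v : Val} (h : M.toVal? = some v) :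
    M.decomp = none := by
  cases M with
  | pair M N =>
    simp only [Tm.toVal?] at h
    split at h
    · next h₁ h₂ => simp [Tm.decomp, h₁, h₂]
    · simp at h
  | _ => first | rfl | simp [Tm.toVal?] at h

@[simp] theorem Val.decomp_toTm (v : Val) : v.toTm.decomp = none :=
  Tm.decomp_eq_none_of_toVal? v.toVal?_toTm

/-- Redexes are the terms that decompose into the empty context and themselves. -/
def Tm.IsRedex (r : Tm) : Prop := r.decomp = some (.hole, r)

theorem Tm.IsRedex.toVal? {r : Tm} (h : r.IsRedex) : r.toVal? = none := by
  cases hv : r.toVal? with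
  | none => rfl
  | some v =>
    rw [Tm.IsRedex, Tm.decomp_eq_none_of_toVal? hv] at h
    cases h

theorem ECtx.toVal?_plug {r : Tm} (h : r.IsRedex) (E : ECtx) : (E.plug r).toVal? = none := by
  induction E with
  | hole => exact h.toVal?
  | pairL E N ih => simp [ECtx.plug, Tm.toVal?, ih]
  | pairR v E ih => simp [ECtx.plug, Tm.toVal?, ih]
  | _ => rfl

theorem ECtx.decomp_plug {r : Tm} (h : r.IsRedex) (E : ECtx) :
    (E.plug r).decomp = some (E, r) := by
  induction E with
  | hole => exact h
  | opR o i E ih =>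
    simp [ECtx.plug, Tm.decomp, ECtx.toVal?_plug h, ih, show (Tm.int i).toVal? = some (.int i) from rfl]
  | _ => simp_all [ECtx.plug, Tm.decomp, ECtx.toVal?_plug h]

/-- The composition `E[F]` of evaluation contexts. -/
def ECtx.comp : ECtx → ECtx → ECtx
  | .hole, F => F
  | .opL o E N, F => .opL o (E.comp F) N
  | .opR o i E, F => .opR o i (E.comp F)
  | .ite E N N', F => .ite (E.comp F) N N'
  | .fst E, F => .fst (E.comp F)
  | .snd E, F => .snd (E.comp F)
  | .pairL E N, F => .pairL (E.comp F) N
  | .pairR v E, F => .pairR v (E.comp F)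
  | .appMeth m E, F => .appMeth m (E.comp F)
  | .letin x E N, F => .letin x (E.comp F) N
  | .assign r E, F => .assign r (E.comp F)

theorem ECtx.plug_comp (E F : ECtx) (M : Tm) : (E.comp F).plug M = E.plug (F.plug M) := by
  induction E <;> simp_all [ECtx.comp, ECtx.plug]

/-- The reductions of `TStep` without their evaluation contexts. -/
inductive HeadStep (t : ℕ) : Tm × Repo × Store → Tm × Repo × Store → Prop where
  | tid (R : Repo) (S : Store) : HeadStep t (.tid, R, S) (.int t, R, S)
  | op (R : Repo) (S : Store) (o : Op) (i j : ℤ) :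
      HeadStep t (.op o (.int i) (.int j), R, S) (.int (o.eval i j), R, S)
  | deref (R : Repo) (S : Store) (r : Ref) (v : Val) : S r = some v →
      HeadStep t (.deref r, R, S) (v.toTm, R, S)
  | iteZero (R : Repo) (S : Store) (M₁ M₀ : Tm) :
      HeadStep t (.ite (.int 0) M₁ M₀, R, S) (M₀, R, S)
  | iteNonzero (R : Repo) (S : Store) (i : ℤ) (M₁ M₀ : Tm) : i ≠ 0 →
      HeadStep t (.ite (.int i) M₁ M₀, R, S) (M₁, R, S)
  | assign (R : Repo) (S : Store) (r : Ref) (v : Val) :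
      HeadStep t (.assign r v.toTm, R, S) (.unit, R, Function.update S r (some v))
  | lam (R : Repo) (S : Store) (x : Var) (θ : Ty) (M : Tm) (m : Meth) : R m = none →
      HeadStep t (.lam x θ M, R, S) (.meth m, Function.update R m (some (x, M)), S)
  | app (R : Repo) (S : Store) (m : Meth) (v : Val) (x : Var) (M : Tm) : R m = some (x, M) →
      HeadStep t (.appMeth m v.toTm, R, S) (M.subst x v, R, S)
  | fst (R : Repo) (S : Store) (v w : Val) :
      HeadStep t (.fst (.pair v.toTm w.toTm), R, S) (v.toTm, R, S)
  | snd (R : Repo) (S : Store) (v w : Val) :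
      HeadStep t (.snd (.pair v.toTm w.toTm), R, S) (w.toTm, R, S)
  | letin (R : Repo) (S : Store) (x : Var) (v : Val) (M : Tm) :
      HeadStep t (.letin x v.toTm M, R, S) (M.subst x v, R, S)
  | acquire (R : Repo) (S : Store) (r : Ref) : S r = some (.int 0) →
      HeadStep t (.acquire r, R, S) (.unit, R, Function.update S r (some (.int 1)))
  | release (R : Repo) (S : Store) (r : Ref) :
      HeadStep t (.release r, R, S) (.unit, R, Function.update S r (some (.int 0)))

theorem isRedex_appMeth (m : Meth) (v : Val) : (Tm.appMeth m v.toTm).IsRedex := by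
  simp [Tm.IsRedex, Tm.decomp]

theorem HeadStep.isRedex {t : ℕ} {r r' : Tm} {R R' : Repo} {S S' : Store}
    (h : HeadStep t (r, R, S) (r', R', S')) : r.IsRedex := by
  cases h <;> simp [Tm.IsRedex, Tm.decomp, Tm.toVal?]

/-- Every reduction contracts the redex that the decomposition of the term singles out. -/
theorem TStep.exists_headStep {t : ℕ} {M M' : Tm} {R R' : Repo} {S S' : Store}
    (h : TStep t (M, R, S) (M', R', S')) :
    ∃ (E : ECtx) (r r' : Tm), M.decomp = some (E, r) ∧ M' = E.plug r' ∧ HeadStep t (r, R, S) (r', R', S') := by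
  suffices ∃ (E : ECtx) (r r' : Tm), M = E.plug r ∧ M' = E.plug r' ∧ HeadStep t (r, R, S) (r', R', S') by
    obtain ⟨E, r, r', rfl, rfl, hs⟩ := this
    exact ⟨E, r, r', ECtx.decomp_plug hs.isRedex E, rfl, hs⟩
  cases h
  case tid => exact ⟨_, _, _, rfl, rfl, .tid ..⟩
  case op => exact ⟨_, _, _, rfl, rfl, .op ..⟩
  case deref h => exact ⟨_, _, _, rfl, rfl, .deref _ _ _ _ h⟩
  case iteZero => exact ⟨_, _, _, rfl, rfl, .iteZero ..⟩
  case iteNonzero h => exact ⟨_, _, _, rfl, rfl, .iteNonzero _ _ _ _ _ h⟩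
  case assign => exact ⟨_, _, _, rfl, rfl, .assign ..⟩
  case lam h => exact ⟨_, _, _, rfl, rfl, .lam _ _ _ _ _ _ h⟩
  case app h => exact ⟨_, _, _, rfl, rfl, .app _ _ _ _ _ _ h⟩
  case fst => exact ⟨_, _, _, rfl, rfl, .fst ..⟩
  case snd => exact ⟨_, _, _, rfl, rfl, .snd ..⟩
  case letin => exact ⟨_, _, _, rfl, rfl, .letin ..⟩
  case acquire h => exact ⟨_, _, _, rfl, rfl, .acquire _ _ _ h⟩
  case release => exact ⟨_, _, _, rfl, rfl, .release ..⟩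

/-! ### Deterministic reductions -/

/-- The contractum of a redex whose reduction neither depends on the contents of `F` and of the
lock nor changes the repository or the store. The method name `u` is the contents of `updR`, which
never changes; the bodies of methods in `R` never change either. -/
def detHead (u : Meth) (R : Repo) : Tm → Option Tm
  | .op o (.int i) (.int j) => some (.int (o.eval i j))
  | .ite (.int i) M₁ M₀ => some (if i = 0 then M₀ else M₁)
  | .fst (.pair M _) => some M
  | .snd (.pair _ N) => some N
  | .letin x M N => M.toVal?.map fun v => N.subst x v
  | .appMeth m M => M.toVal?.bind fun v => (R m).map fun b => b.2.subst b.1 v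
  | .deref (.fn (.prod .int (.prod (.arrow .int .int) .int)) .int 0) => some (.meth u)
  | _ => none

/-- A deterministic reduction of a term, as a partial function. -/
def detStep (u : Meth) (R : Repo) (M : Tm) : Option Tm :=
  M.decomp.bind fun p => (detHead u R p.2).map p.1.plug

/-- Finite sequences of deterministic reductions. -/
def DetSteps (u : Meth) (R : Repo) : Tm → Tm → Prop :=
  Relation.ReflTransGen fun M M' => detStep u R M = some M'

/-- The repository `R'` extends `R`. -/
def Repo.Le (R R' : Repo) : Prop := ∀ m b, R m = some b → R' m = some b

theorem Repo.le_refl (R : Repo) : R.Le R := fun _ _ h => h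

theorem Repo.le_update {R : Repo} {m : Meth} (h : R m = none) (b : Var × Tm) :
    R.Le (Function.update R m (some b)) := by
  intro n c hn
  rw [Function.update_of_ne (by rintro rfl; simp [h] at hn)]
  exact hn

theorem detHead_mono {u : Meth} {R R' : Repo} (hR : R.Le R') {r r' : Tm}
    (h : detHead u R r = some r') : detHead u R' r = some r' := by
  unfold detHead at h ⊢
  split at h <;> try exact h
  simp only [Option.bind_eq_some_iff, Option.map_eq_some_iff] at h ⊢
  obtain ⟨v, hv, b, hb, rfl⟩ := h
  exact ⟨v, hv, b, hR _ _ hb, rfl⟩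

theorem DetSteps.mono {u : Meth} {R R' : Repo} (hR : R.Le R') {M M' : Tm}
    (h : DetSteps u R M M') : DetSteps u R' M M' := by
  refine Relation.ReflTransGen.mono ?_ _ _ h
  intro M M' h
  simp only [detStep, Option.bind_eq_some_iff, Option.map_eq_some_iff] at h ⊢
  obtain ⟨p, hp, r, hr, rfl⟩ := h
  exact ⟨p, hp, r, detHead_mono hR hr, rfl⟩

theorem DetSteps.refl {u : Meth} {R : Repo} {M : Tm} : DetSteps u R M M :=
  Relation.ReflTransGen.refl

theorem DetSteps.head {u : Meth} {R : Repo} {M M' M'' : Tm} (h : detStep u R M = some M')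
    (h' : DetSteps u R M' M'') : DetSteps u R M M'' :=
  Relation.ReflTransGen.head h h'

theorem DetSteps.trans {u : Meth} {R : Repo} {M M' M'' : Tm} (h : DetSteps u R M M')
    (h' : DetSteps u R M' M'') : DetSteps u R M M'' :=
  Relation.ReflTransGen.trans h h'

theorem detStep_plug {u : Meth} {R : Repo} (E : ECtx) {r r' : Tm} (hr : r.IsRedex)
    (h : detHead u R r = some r') : detStep u R (E.plug r) = some (E.plug r') := by
  simp [detStep, ECtx.decomp_plug hr, h]

/-- Where a deterministic reduction is possible, it is the only reduction. -/
theorem HeadStep.eq_of_detHead {t : ℕ} {u : Meth} {r r₁ r₂ : Tm} {R R' : Repo} {S S' : Store}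
    (hu : S updR = some (.meth u)) (h : HeadStep t (r, R, S) (r₁, R', S'))
    (h' : detHead u R r = some r₂) : r₁ = r₂ ∧ R' = R ∧ S' = S := by
  cases h
  case deref r v h =>
    unfold detHead at h'
    split at h'
    case h_7 heq =>
      cases heq
      cases h'
      rw [show Ref.fn _ _ 0 = updR from rfl, hu] at h
      cases h
      exact ⟨rfl, rfl, rfl⟩
    all_goals simp_all
  case iteNonzero i M₀ h => simp_all [detHead]
  all_goals simp_all [detHead]

/-- A reduction of a term that evaluates deterministically to `N` either makes progress towards `N`
and leaves the repository and the store unchanged, or is a reduction of `N` itself. -/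
theorem TStep.detSteps_cases {t : ℕ} {u : Meth} {M M' N : Tm} {R R' : Repo} {S S' : Store}
    (hu : S updR = some (.meth u)) (hN : DetSteps u R M N) (h : TStep t (M, R, S) (M', R', S')) :
    (DetSteps u R M' N ∧ R' = R ∧ S' = S) ∨ M = N := by
  rcases Relation.ReflTransGen.cases_head hN with rfl | ⟨M₁, h₁, h₂⟩
  · exact .inr rfl
  · left
    obtain ⟨E, r, r', hd, rfl, hs⟩ := h.exists_headStep
    simp only [detStep, hd, Option.bind_some, Option.map_eq_some_iff] at h₁
    obtain ⟨r₂, hr₂, rfl⟩ := h₁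
    obtain ⟨rfl, rfl, rfl⟩ := hs.eq_of_detHead hu hr₂
    exact ⟨h₂, rfl, rfl⟩

theorem DetSteps.eq_of_detStep_eq_none {u : Meth} {R : Repo} {M N : Tm} (h : DetSteps u R M N)
    (hM : detStep u R M = none) : M = N := by
  rcases Relation.ReflTransGen.cases_head h with rfl | ⟨M₁, h₁, -⟩
  · rfl
  · simp [hM] at h₁

theorem detStep_plug_appMeth {u : Meth} {R : Repo} {m : Meth} (hm : R m = none) (E : ECtx)
    (v : Val) : detStep u R (E.plug (.appMeth m v.toTm)) = none := by
  simp [detStep, ECtx.decomp_plug (isRedex_appMeth m v), detHead, hm]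

theorem detStep_toTm {u : Meth} {R : Repo} (v : Val) : detStep u R v.toTm = none := by
  simp [detStep]

/-- The method `f` computes the function `φ` on integers, by deterministic reductions. -/
def Represents (u : Meth) (R : Repo) (f : Meth) (φ : ℤ → ℤ) : Prop :=
  ∀ (E : ECtx) (k : ℤ), DetSteps u R (E.plug (.appMeth f (.int k))) (E.plug (.int (φ k)))

theorem Represents.mono {u : Meth} {R R' : Repo} (hR : R.Le R') {f : Meth} {φ : ℤ → ℤ}
    (h : Represents u R f φ) : Represents u R' f φ := fun E k => (h E k).mono hR

/-- The body of the function that `writeF` stores. -/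
def updatedBody (i y : ℤ) (f : Meth) : Tm :=
  .ite (.op .eq (.var vx) (.int i)) (.int y) (.appMeth f (.var vx))

theorem represents_zero {u : Meth} {R : Repo} {f : Meth} (h : R f = some (vx, .int 0)) :
    Represents u R f fun _ => 0 := by
  intro E k
  refine .head (detStep_plug E (isRedex_appMeth f (.int k)) (r' := .int 0) ?_) .refl
  simp [detHead, h, Tm.toVal?, Tm.subst]

theorem represents_update {u : Meth} {R : Repo} {f m : Meth} {φ : ℤ → ℤ} {i y : ℤ}
    (hf : Represents u R f φ) (h : R m = some (vx, updatedBody i y f)) :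
    Represents u R m (Function.update φ i y) := by
  intro E k
  refine .head (detStep_plug E (isRedex_appMeth m (.int k))
    (r' := .ite (.op .eq (.int k) (.int i)) (.int y) (.appMeth f (.int k))) ?_) ?_
  · simp [detHead, h, Tm.toVal?, Tm.subst, updatedBody, Val.toTm]
  have h₁ := detStep_plug (u := u) (R := R)
    (E.comp (.ite .hole (.int y) (.appMeth f (.int k)))) (r := .op .eq (.int k) (.int i))
    (r' := .int (Op.eval .eq k i)) (by simp [Tm.IsRedex, Tm.decomp, Tm.toVal?]) rfl
  simp only [ECtx.plug_comp, ECtx.plug] at h₁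
  refine .head h₁ ?_
  by_cases hk : k = i
  · subst hk
    refine .head (detStep_plug E (r' := .int y) (by simp [Tm.IsRedex, Tm.decomp, Tm.toVal?]) ?_) ?_
    · simp [detHead, Op.eval]
    · simpa using .refl
  · refine .head (detStep_plug E (r' := .appMeth f (.int k))
      (by simp [Tm.IsRedex, Tm.decomp, Tm.toVal?]) ?_) ?_
    · simp [detHead, Op.eval, hk]
    · simpa [hk] using hf E k

/-! ### Reordering of moves -/

/-- An adjacent swap of moves of different threads that makes an `O`-move later or a `P`-move
earlier, without the requirement that the sequences be histories. -/
inductive Reorder : List Move → List Move → Prop where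
  | mk (s₁ s₂ : List Move) (x x' : Move) : x'.thread ≠ x.thread →
      x'.act.who = .O ∨ x.act.who = .P → Reorder (s₁ ++ x' :: x :: s₂) (s₁ ++ x :: x' :: s₂)

/-- Finite sequences of such swaps. -/
abbrev Reorders : List Move → List Move → Prop := Relation.ReflTransGen Reorder

theorem Reorders.append_right {a b : List Move} (h : Reorders a b) (c : List Move) :
    Reorders (a ++ c) (b ++ c) := by
  induction h with
  | refl => exact .refl
  | tail _ hs ih =>
    refine ih.tail ?_
    cases hs with
    | mk s₁ s₂ x x' h₁ h₂ => simpa using Reorder.mk s₁ (s₂ ++ c) x x' h₁ h₂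

theorem Reorders.append_left {a b : List Move} (h : Reorders a b) (c : List Move) :
    Reorders (c ++ a) (c ++ b) := by
  induction h with
  | refl => exact .refl
  | tail _ hs ih =>
    refine ih.tail ?_
    cases hs with
    | mk s₁ s₂ x x' h₁ h₂ => simpa using Reorder.mk (c ++ s₁) s₂ x x' h₁ h₂

/-- A `P`-move moves before any moves of other threads, and any move before `O`-moves of other
threads. -/
theorem reorders_move_earlier {p : Move} {a : List Move}
    (h : ∀ y ∈ a, y.thread ≠ p.thread ∧ (y.act.who = .O ∨ p.act.who = .P)) (c : List Move) :
    Reorders (a ++ p :: c) (p :: (a ++ c)) := by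
  induction a with
  | nil => exact .refl
  | cons y a ih =>
    have h₁ := (ih fun z hz => h z (List.mem_cons_of_mem _ hz)).append_left [y]
    exact h₁.tail (.mk [] (a ++ c) p y (h y (by simp)).1 (h y (by simp)).2)

/-- An `O`-move moves after any moves of other threads, and any move after `P`-moves of other
threads. -/
theorem reorders_move_later {o : Move} {a : List Move}
    (h : ∀ y ∈ a, y.thread ≠ o.thread ∧ (o.act.who = .O ∨ y.act.who = .P)) (c : List Move) :
    Reorders (o :: (a ++ c)) (a ++ o :: c) := by
  induction a with
  | nil => exact .refl
  | cons y a ih =>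
    have h₁ := (ih fun z hz => h z (List.mem_cons_of_mem _ hz)).append_left [y]
    exact .head (.mk [] (a ++ c) y o (h y (by simp)).1.symm (h y (by simp)).2) h₁

/-- The moves of thread `t`. -/
abbrev ofThread (t : ℕ) (h : List Move) : List Move := h.filter fun x => x.thread = t

theorem Reorders.ofThread_eq {a b : List Move} (h : Reorders a b) (t : ℕ) :
    ofThread t a = ofThread t b := by
  induction h with
  | refl => rfl
  | tail _ hs ih =>
    rw [ih]
    cases hs with
    | mk s₁ s₂ x x' h₁ h₂ =>
      by_cases hx : x.thread = t
      · have : x'.thread ≠ t := fun h => h₁ (h.trans hx.symm)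
        simp [hx, this]
      · simp [List.filter_cons, hx]

/-- The names that a thread receives or sends do not occur in the moves of other threads. -/
def ThreadLocal (h : List Move) : Prop :=
  ∀ x ∈ h, ∀ y ∈ h, x.thread ≠ y.thread → ∀ m ∈ x.act.val.names, m ∉ y.names

theorem mem_iff_of_ofThread_eq {h h' : List Move} (hh : ∀ t, ofThread t h = ofThread t h')
    (x : Move) : x ∈ h ↔ x ∈ h' := by
  have : ∀ l : List Move, x ∈ l ↔ x ∈ ofThread x.thread l := fun l => by simp
  rw [this h, this h', hh]

theorem ThreadLocal.of_ofThread_eq {h h' : List Move} (hl : ThreadLocal h)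
    (hh : ∀ t, ofThread t h = ofThread t h') : ThreadLocal h' := fun x hx y hy =>
  hl x ((mem_iff_of_ofThread_eq hh x).2 hx) y ((mem_iff_of_ofThread_eq hh y).2 hy)

/-- An occurrence of a move in `h'` and the corresponding occurrence in `h` are preceded by the
same moves of their thread. -/
theorem exists_split_of_ofThread_eq {h h' : List Move} (hh : ∀ t, ofThread t h = ofThread t h')
    {s₁ s₂ : List Move} {x : Move} (hx : h' = s₁ ++ x :: s₂) :
    ∃ r₁ r₂, h = r₁ ++ x :: r₂ ∧ ofThread x.thread r₁ = ofThread x.thread s₁ := by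
  have h₁ : ofThread x.thread h = ofThread x.thread s₁ ++ x :: ofThread x.thread s₂ := by
    rw [hh, hx]
    simp
  obtain ⟨a, b, rfl, ha, hb⟩ := List.filter_eq_append_iff.1 h₁
  obtain ⟨c, d, rfl, hc, -, -⟩ := List.filter_eq_cons_iff.1 hb
  refine ⟨a ++ c, d, by simp, ?_⟩
  simp only [ofThread, List.filter_append, ha]
  rw [List.filter_eq_nil_iff.2 hc, List.append_nil]

/-- If names are not shared between threads, then being a history depends only on the sequences of
moves of the single threads. -/
theorem IsHist.of_ofThread_eq {Θ Θ' : Finset Meth} {h h' : List Move} (H : IsHist Θ Θ' h)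
    (hl : ThreadLocal h) (hh : ∀ t, ofThread t h = ofThread t h') : IsHist Θ Θ' h' := by
  have hmem := mem_iff_of_ofThread_eq hh
  refine ⟨?_, ?_, ?_⟩
  · obtain ⟨N, hN, hr, hp⟩ := H.threads
    refine ⟨N, hN, fun x hx => hr x ((hmem x).2 hx), fun t h₁ h₂ => ?_⟩
    have : proj h' t = proj h t := congrArg (List.map Move.act) (hh t).symm
    exact this ▸ hp t h₁ h₂
  · intro s₁ s₂ x hx hc
    obtain ⟨r₁, r₂, rfl, hr⟩ := exists_split_of_ofThread_eq hh hx
    rcases H.calls r₁ r₂ x rfl hc with h₁ | h₁ | ⟨y, hy, h₁, h₂, h₃⟩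
    · exact .inl h₁
    · exact .inr (.inl h₁)
    · refine .inr (.inr ⟨y, ?_, h₁, h₂, h₃⟩)
      have ht : y.thread = x.thread := by
        by_contra ht
        exact hl y (by simp [hy]) x (by simp) ht _ h₃ (by simp [Move.names])
      have : y ∈ ofThread x.thread r₁ := by simp [hy, ht]
      rw [hr] at this
      exact (List.mem_filter.1 this).1
  · intro s₁ s₂ x hx m hm y hy
    obtain ⟨r₁, r₂, rfl, hr⟩ := exists_split_of_ofThread_eq hh hx
    by_cases ht : y.thread = x.thread
    · have : y ∈ ofThread x.thread s₁ := by simp [hy, ht]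
      rw [← hr] at this
      exact H.fresh r₁ r₂ x rfl m hm y (List.mem_filter.1 this).1
    · exact hl x (by simp) y ((hmem y).2 (by simp [hx, hy])) (Ne.symm ht) m hm

/-- The side conditions of the swaps hold along every reordering, since being a history is invariant
under reordering. The relation `Diamond` is not needed. -/
theorem Reorders.enc_swaps {Θ Θ' : Finset Meth} {h h' : List Move} (H : IsHist Θ Θ' h)
    (hl : ThreadLocal h) (hr : Reorders h h') :
    Relation.ReflTransGen (fun a b => Swap Θ Θ' .P .O a b ∨ Diamond Θ Θ' a b) h h' := by
  induction hr with
  | refl => exact .refl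
  | @tail b c hb hs ih =>
    refine ih.tail (.inl ?_)
    have h₁ : IsHist Θ Θ' b := H.of_ofThread_eq hl (Reorders.ofThread_eq hb)
    have h₂ : IsHist Θ Θ' c := H.of_ofThread_eq hl (Reorders.ofThread_eq (hb.tail hs))
    cases hs with
    | mk s₁ s₂ x x' ht hw =>
      rcases hw with hw | hw
      · exact .later s₁ s₂ x x' ht hw h₁ h₂
      · exact .earlier s₁ s₂ x x' ht hw h₁ h₂

/-! ### Words of the grammar -/

/-- The moves of thread `t` in a sequence of extended moves. -/
abbrev xofThread (t : ℕ) (s : List XMove) : List XMove := s.filter fun x => x.1.thread = t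

theorem map_fst_xofThread (t : ℕ) (s : List XMove) :
    (xofThread t s).map Prod.fst = ofThread t (s.map Prod.fst) := by
  rw [ofThread, List.filter_map]
  rfl

theorem SpecS.append {t : ℕ} {a b : List XMove} (ha : SpecS t a) (hb : SpecS t b) :
    SpecS t (a ++ b) := by
  refine SpecS.rec (motive_1 := fun a _ => SpecS t (a ++ b)) (motive_2 := fun _ _ _ _ _ _ _ => True)
    hb ?_ ?_ ?_ ?_ ?_ ha
  · intro i I s _ ih
    exact .count i I _ ih
  · intro i j m I J w s hw _ _ ih
    have := SpecS.update i j m I J w (s ++ b) hw ih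
    simpa using this
  · intro i j I s _ ih
    exact .updateEnc i j I _ ih
  · intros
    trivial
  · intros
    trivial

/-- The names of the public and abstract methods of the library. -/
def baseMeths : Finset Meth := {count, update, updateEnc, foo}

mutual

/-- The methods that a thread calls are methods of the interface or occur in its values. -/
theorem SpecS.meth_mem {t : ℕ} {w : List XMove} : SpecS t w → ∀ x ∈ w,
    x.1.act.meth ∈ baseMeths ∨ ∃ y ∈ w, x.1.act.meth ∈ y.1.act.val.names
  | .nil => by simp
  | .count i I s hs => by
    have ih := SpecS.meth_mem hs
    intro x hx
    simp only [List.mem_cons] at hx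
    rcases hx with rfl | rfl | hx
    · exact .inl (by simp [xcall, baseMeths])
    · exact .inl (by simp [xret, baseMeths])
    · rcases ih x hx with h | ⟨y, hy, h⟩
      · exact .inl h
      · exact .inr ⟨y, by simp [hy], h⟩
  | .update i j m I J w s hw hs => by
    have ih := SpecS.meth_mem hs
    have ihw := SpecM.meth_mem hw
    intro x hx
    simp only [List.mem_cons, List.mem_append] at hx
    rcases hx with rfl | hx | rfl | hx
    · exact .inl (by simp [xcall, baseMeths])
    · rcases ihw x hx with h | h | ⟨y, hy, h⟩
      · exact .inl h
      · exact .inr ⟨_, List.mem_cons_self, by simp [h, xcall, Val.names]⟩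
      · exact .inr ⟨y, by simp [hy], h⟩
    · exact .inl (by simp [xret, baseMeths])
    · rcases ih x hx with h | ⟨y, hy, h⟩
      · exact .inl h
      · exact .inr ⟨y, by simp [hy], h⟩
  | .updateEnc i j I s hs => by
    have ih := SpecS.meth_mem hs
    intro x hx
    simp only [List.mem_cons] at hx
    rcases hx with rfl | rfl | rfl | rfl | hx
    · exact .inl (by simp [xcall, baseMeths])
    · exact .inl (by simp [xcall, baseMeths])
    · exact .inl (by simp [xret, baseMeths])
    · exact .inl (by simp [xret, baseMeths])
    · rcases ih x hx with h | ⟨y, hy, h⟩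
      · exact .inl h
      · exact .inr ⟨y, by simp [hy], h⟩

theorem SpecM.meth_mem {t : ℕ} {m : Meth} {i j : ℤ} {I J : Multiset ℤ} {w : List XMove} :
    SpecM t m i j I J w → ∀ x ∈ w,
    x.1.act.meth ∈ baseMeths ∨ x.1.act.meth = m ∨ ∃ y ∈ w, x.1.act.meth ∈ y.1.act.val.names
  | .done m i j I J s hs _ => by
    have ih := SpecS.meth_mem hs
    intro x hx
    simp only [List.mem_cons, List.mem_append, List.not_mem_nil, or_false] at hx
    rcases hx with rfl | hx | rfl
    · exact .inr (.inl rfl)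
    · rcases ih x hx with h | ⟨y, hy, h⟩
      · exact .inl h
      · exact .inr (.inr ⟨y, by simp [hy], h⟩)
    · exact .inr (.inl rfl)
  | .retry m i j j' I J' J s w hs _ hw => by
    have ih := SpecS.meth_mem hs
    have ihw := SpecM.meth_mem hw
    intro x hx
    simp only [List.mem_cons, List.mem_append] at hx
    rcases hx with rfl | hx | rfl | hx
    · exact .inr (.inl rfl)
    · rcases ih x hx with h | ⟨y, hy, h⟩
      · exact .inl h
      · exact .inr (.inr ⟨y, by simp [hy], h⟩)
    · exact .inr (.inl rfl)
    · rcases ihw x hx with h | h | ⟨y, hy, h⟩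
      · exact .inl h
      · exact .inr (.inl h)
      · exact .inr (.inr ⟨y, by simp [hy], h⟩)

end

/-- The encapsulation condition on consecutive moves of a thread. -/
def SameSide (x y : XMove) : Prop :=
  x.1.act.who = .P → y.1.act.who = .O → x.1.act.side = y.1.act.side

mutual

/-- In a word of `𝒮`, consecutive moves satisfy the encapsulation condition; the word starts and
ends with client moves. -/
theorem SpecS.isChain {t : ℕ} {w : List XMove} : SpecS t w →
    w.IsChain SameSide ∧ (∀ x ∈ w.head?, x.1.act.side = .K) ∧ ∀ x ∈ w.getLast?, x.1.act.side = .K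
  | .nil => by simp
  | .count i I s hs => by
    obtain ⟨h₁, h₂, h₃⟩ := SpecS.isChain hs
    refine ⟨?_, by simp [xcall], ?_⟩
    · refine .cons_cons (by simp [SameSide, xcall]) (List.isChain_cons.2 ⟨?_, h₁⟩)
      intro y hy _ _
      simp [h₂ y hy, xret]
    · cases s with
      | nil => simp [xret]
      | cons y s => simpa using h₃
  | .update i j m I J w s hw hs => by
    obtain ⟨h₁, h₂, h₃⟩ := SpecS.isChain hs
    obtain ⟨w₁, w₂, w₃⟩ := SpecM.isChain hw
    refine ⟨?_, by simp [xcall], ?_⟩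
    · refine List.isChain_cons.2 ⟨?_, List.isChain_append.2 ⟨w₁, List.isChain_cons.2 ⟨?_, h₁⟩, ?_⟩⟩
      · intro y _ h
        simp [xcall] at h
      · intro y hy _ _
        simp [h₂ y hy, xret]
      · intro x _ y hy _ h
        simp only [List.head?_cons, Option.mem_def, Option.some.injEq] at hy
        subst hy
        simp [xret] at h
    · rw [← List.cons_append, List.getLast?_append_cons]
      cases s with
      | nil => simp [xret]
      | cons y s => simpa using h₃
  | .updateEnc i j I s hs => by
    obtain ⟨h₁, h₂, h₃⟩ := SpecS.isChain hs
    refine ⟨?_, by simp [xcall], ?_⟩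
    · refine .cons_cons (by simp [SameSide, xcall]) (.cons_cons (by simp [xret, xcall, SameSide])
        (.cons_cons (by simp [SameSide, xret]) (List.isChain_cons.2 ⟨?_, h₁⟩)))
      intro y hy _ _
      simp [h₂ y hy, xret]
    · cases s with
      | nil => simp [xret]
      | cons y s => simpa using h₃

theorem SpecM.isChain {t : ℕ} {m : Meth} {i j : ℤ} {I J : Multiset ℤ} {w : List XMove} :
    SpecM t m i j I J w →
    w.IsChain SameSide ∧ (∀ x ∈ w.head?, x.1.act.side = .K) ∧ ∀ x ∈ w.getLast?, x.1.act.side = .K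
  | .done m i j I J s hs _ => by
    obtain ⟨h₁, h₂, h₃⟩ := SpecS.isChain hs
    refine ⟨?_, by simp [xcall], ?_⟩
    · refine List.isChain_cons.2 ⟨?_, List.isChain_append.2 ⟨h₁, List.isChain_singleton _, ?_⟩⟩
      · intro y hy _ _
        cases s with
        | nil =>
          simp only [List.nil_append, List.head?_cons, Option.mem_def, Option.some.injEq] at hy
          subst hy
          rfl
        | cons z s => exact (h₂ y (by simpa using hy)).symm
      · intro x hx y hy _ _
        simp only [List.head?_cons, Option.mem_def, Option.some.injEq] at hy
        subst hy
        exact h₃ x hx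
    · rw [← List.cons_append, List.getLast?_append_cons]
      simp [xret]
  | .retry m i j j' I J' J s w hs _ hw => by
    obtain ⟨h₁, h₂, h₃⟩ := SpecS.isChain hs
    obtain ⟨w₁, w₂, w₃⟩ := SpecM.isChain hw
    refine ⟨?_, by simp [xcall], ?_⟩
    · refine List.isChain_cons.2 ⟨?_, List.isChain_append.2 ⟨h₁, List.isChain_cons.2 ⟨?_, w₁⟩, ?_⟩⟩
      · intro y hy _ _
        cases s with
        | nil =>
          simp only [List.nil_append, List.head?_cons, Option.mem_def, Option.some.injEq] at hy
          subst hy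
          rfl
        | cons z s => exact (h₂ y (by simpa using hy)).symm
      · intro y _ h
        simp [xret] at h
      · intro x hx y hy _ _
        simp only [List.head?_cons, Option.mem_def, Option.some.injEq] at hy
        subst hy
        exact h₃ x hx
    · rw [← List.cons_append, List.getLast?_append_cons]
      cases w with
      | nil => simp [xret]
      | cons y s => simpa using w₃

end

theorem encapsulated_of_specS {s : List XMove} (h : ∀ t, SpecS t (xofThread t s)) :
    Encapsulated (s.map Prod.fst) := by
  intro s₁ s₂ s₃ x y hs ht hn hx hy
  have h₁ := congrArg (ofThread x.thread) hs
  rw [← map_fst_xofThread] at h₁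
  have h₂ : ofThread x.thread s₂ = [] := by
    rw [List.filter_eq_nil_iff]
    simpa using hn
  simp only [ofThread, List.filter_append, List.filter_cons, decide_true, if_true, ← ht] at h₁
  rw [show s₂.filter (fun z => decide (z.thread = x.thread)) = [] from h₂, List.nil_append] at h₁
  have h₃ := (h x.thread).isChain.1
  obtain ⟨a, b, hab, -, hb⟩ := List.map_eq_append_iff.1 h₁
  obtain ⟨x', b, rfl, rfl, hb⟩ := List.map_eq_cons_iff.1 hb
  obtain ⟨y', b, rfl, rfl, hb⟩ := List.map_eq_cons_iff.1 hb
  rw [hab] at h₃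
  exact (List.isChain_append.1 h₃).2.1.rel hx hy

/-- The consequence of encapsulation for the next move of a thread. -/
theorem Encapsulated.side_eq {h s : List Move} {x y : Move} (H : Encapsulated (h ++ y :: s))
    (hx : (ofThread y.thread h).getLast? = some x) (hP : x.act.who = .P) (hO : y.act.who = .O) :
    x.act.side = y.act.side := by
  obtain ⟨l, hl⟩ := List.getLast?_eq_some_iff.1 hx
  obtain ⟨a, b, rfl, ha, hb⟩ := List.filter_eq_append_iff.1 hl
  obtain ⟨c, d, rfl, hc, hxt, hd⟩ := List.filter_eq_cons_iff.1 hb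
  have hxt : x.thread = y.thread := by simpa using hxt
  refine H (a ++ c) d s x y (by simp) hxt (fun z hz => ?_) hP hO
  have := List.filter_eq_nil_iff.1 hd z hz
  simpa [hxt] using this

/-- An unanswered call that is made by `update (i, g)`: the call of `g` with the multiplicity of `i`
in the multiset `I`. -/
structure Frame where
  i : ℤ
  g : Meth
  I : Multiset ℤ

/-- The words that consist of the beginning of a call of `update` up to and including an unanswered
call of `g`, accompanied by `I`, and of a complete word of `𝒮`. The condition on the beginning `v₀`
says that every word that `ℳ` generates from that call of `g` onwards completes it to a word
of `𝒮`. -/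
def Frame.Open (t : ℕ) (F : Frame) (v : List XMove) : Prop :=
  ∃ v₀ s, v = v₀ ++ xcall t F.g (.int (F.I.count F.i)) .P .K F.I :: s ∧ SpecS t s ∧
    ∀ j J w, SpecM t F.g F.i j F.I J w →
      SpecS t (v₀ ++ (w ++ [xret t update (.int |j|) .P .K (setMult J F.i j.natAbs)]))

/-- The words of a thread with unanswered calls as in the list of frames, innermost first. -/
inductive Partial (t : ℕ) : List Frame → List XMove → Prop
  | nil (w : List XMove) : SpecS t w → Partial t [] w
  | cons (F : Frame) (fs : List Frame) (w v : List XMove) : Partial t fs w → F.Open t v →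
      Partial t (F :: fs) (w ++ v)

theorem Partial.append {t : ℕ} {fs : List Frame} {w s : List XMove} (h : Partial t fs w)
    (hs : SpecS t s) : Partial t fs (w ++ s) := by
  cases h with
  | nil _ hw => exact .nil _ (hw.append hs)
  | cons F fs w v hw hv =>
    rw [List.append_assoc]
    refine .cons F fs w _ hw ?_
    obtain ⟨v₀, s', rfl, hs', hv⟩ := hv
    exact ⟨v₀, s' ++ s, by simp, hs'.append hs, hv⟩

/-- The linearisation of a call of `update` together with the first call of its argument. -/
theorem Partial.openUpdate {t : ℕ} {fs : List Frame} {w : List XMove} (h : Partial t fs w) (i : ℤ)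
    (g : Meth) (I : Multiset ℤ) :
    Partial t (⟨i, g, I⟩ :: fs) (w ++ [xcall t update (.pair (.int i) (.meth g)) .O .K I,
      xcall t g (.int (I.count i)) .P .K I]) := by
  refine .cons _ _ _ _ h ⟨[xcall t update (.pair (.int i) (.meth g)) .O .K I], [], rfl, .nil, ?_⟩
  intro j J w hw
  exact .update i j g I J w [] hw .nil

/-- The linearisation of a return of the argument of `update` that finds another multiplicity,
together with the next call. -/
theorem Partial.retry {t : ℕ} {F : Frame} {fs : List Frame} {w : List XMove}
    (h : Partial t (F :: fs) w) (j : ℤ) (J : Multiset ℤ) (hJ : F.I.count F.i ≠ J.count F.i) :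
    Partial t (⟨F.i, F.g, J⟩ :: fs) (w ++ [xret t F.g (.int j) .O .K J,
      xcall t F.g (.int (J.count F.i)) .P .K J]) := by
  cases h with
  | cons F fs w v hw hv =>
    rw [List.append_assoc]
    refine .cons _ fs w _ hw ?_
    obtain ⟨v₀, s, rfl, hs, hv⟩ := hv
    refine ⟨v₀ ++ xcall t F.g (.int (F.I.count F.i)) .P .K F.I :: (s ++
      [xret t F.g (.int j) .O .K J]), [], by simp, .nil, fun j' J' w hw => ?_⟩
    have := hv j' J' _ (.retry F.g F.i j' j F.I J J' s w hs hJ hw)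
    simpa using this

/-- The linearisation of a return of the argument of `update` that finds the same multiplicity,
together with the return of `update`. -/
theorem Partial.closeUpdate {t : ℕ} {F : Frame} {fs : List Frame} {w : List XMove}
    (h : Partial t (F :: fs) w) (j : ℤ) (J : Multiset ℤ) (hJ : F.I.count F.i = J.count F.i) :
    Partial t fs (w ++ [xret t F.g (.int j) .O .K J,
      xret t update (.int |j|) .P .K (setMult J F.i j.natAbs)]) := by
  cases h with
  | cons F fs w v hw hv =>
    rw [List.append_assoc]
    refine hw.append ?_
    obtain ⟨v₀, s, rfl, hs, hv⟩ := hv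
    have := hv j J _ (.done F.g F.i j F.I J s hs hJ)
    simpa using this

/-- Sequences of pairs of an `O`-move and a `P`-move of the same thread, where the `O`-moves carry
the multiset of the preceding `P`-move; the first argument is the last multiset. -/
inductive Linear : Multiset ℤ → List XMove → Prop
  | nil : Linear 0 []
  | snoc (I J : Multiset ℤ) (s : List XMove) (t : ℕ) (o p : Act) : Linear I s → o.who = .O →
      p.who = .P → Linear J (s ++ [(⟨t, o⟩, I), (⟨t, p⟩, J)])

theorem Linear.alternating {I : Multiset ℤ} {s : List XMove} (h : Linear I s) :
    Alternating (s.map Prod.fst) := by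
  have happ : ∀ {a b}, Alternating a → Alternating b → Alternating (a ++ b) := by
    intro a b ha hb
    induction ha with
    | nil => exact hb
    | cons t x x' s h₁ h₂ _ ih => exact .cons t x x' _ h₁ h₂ ih
  induction h with
  | nil => exact .nil
  | snoc I J s t o p _ ho hp ih =>
    rw [List.map_append]
    exact happ ih (.cons t o p [] ho hp .nil)

theorem Linear.start {I : Multiset ℤ} {s : List XMove} (h : Linear I s) :
    (s = [] ∧ I = 0) ∨ ∃ x s', s = x :: s' ∧ x.2 = 0 := by
  induction h with
  | nil => exact .inl ⟨rfl, rfl⟩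
  | snoc I J s t o p _ ho hp ih =>
    rcases ih with ⟨rfl, rfl⟩ | ⟨x, s', rfl, hx⟩
    · exact .inr ⟨_, _, rfl, rfl⟩
    · exact .inr ⟨x, _, rfl, hx⟩

theorem Linear.opponent {I : Multiset ℤ} {s : List XMove} (h : Linear I s) :
    s.IsChain (fun x y => x.1.act.who = .P → y.1.act.who = .O → x.2 = y.2) ∧
      ∀ x ∈ s.getLast?, x.2 = I := by
  induction h with
  | nil => simp
  | snoc I J s t o p _ ho hp ih =>
    refine ⟨List.isChain_append.2 ⟨ih.1, ?_, ?_⟩, by simp⟩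
    · simp [ho]
    · intro x hx y hy _ _
      simp only [List.head?_cons, Option.mem_def, Option.some.injEq] at hy
      subst hy
      exact ih.2 x hx

theorem Linear.specExt {I : Multiset ℤ} {s : List XMove} (h : Linear I s)
    (hs : IsHist absMeths pubMeths (s.map Prod.fst)) (ht : ∀ t, SpecS t (xofThread t s)) :
    SpecExt s := by
  refine ⟨⟨hs, h.alternating⟩, ?_, ?_, ht⟩
  · rintro x s' rfl
    rcases h.start with h | ⟨y, s'', hy, h0⟩
    · simp at h
    · cases hy
      exact h0
  · rintro s₁ s₂ x y rfl
    exact (List.isChain_append.1 h.opponent.1).2.1.rel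

/-- Names are not shared between threads if the threads follow the grammar. -/
theorem threadLocal_of_specS {h : List Move} {s : List XMove} (H : IsHist absMeths pubMeths h)
    (hb : ∀ x ∈ h, ∀ m ∈ x.act.val.names, m ∉ baseMeths)
    (hs : ∀ t, ofThread t h = ofThread t (s.map Prod.fst)) (ht : ∀ t, SpecS t (xofThread t s)) :
    ThreadLocal h := by
  have hval : ∀ x ∈ h, ∀ y ∈ h, x.thread ≠ y.thread → ∀ m ∈ x.act.val.names,
      m ∉ y.act.val.names := by
    intro x hx y hy hxy m hm hm'
    have hne : x ≠ y := fun e => hxy (e ▸ rfl)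
    obtain ⟨a, b, rfl⟩ := List.append_of_mem hx
    simp only [List.mem_append, List.mem_cons, hne.symm, false_or] at hy
    rcases hy with hy | hy
    · exact H.fresh a b x rfl m hm y hy (by simp [Move.names, hm'])
    · obtain ⟨c, d, rfl⟩ := List.append_of_mem hy
      exact H.fresh (a ++ x :: c) d y (by simp) m hm' x (by simp) (by simp [Move.names, hm])
  intro x hx y hy hxy m hm hm'
  simp only [Move.names, Finset.mem_insert] at hm'
  rcases hm' with rfl | hm'
  · have hy' : y ∈ (xofThread y.thread s).map Prod.fst := by
      rw [map_fst_xofThread, ← hs]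
      simp [hy]
    obtain ⟨z, hz, rfl⟩ := List.mem_map.1 hy'
    rcases (ht _).meth_mem z hz with h₁ | ⟨z', hz', h₁⟩
    · exact hb x hx _ hm h₁
    · have hz'' : z'.1 ∈ ofThread z.1.thread h := by
        rw [hs, ← map_fst_xofThread]
        exact List.mem_map_of_mem hz'
      rw [List.mem_filter, decide_eq_true_iff] at hz''
      exact hval x hx z'.1 hz''.1 (hz''.2 ▸ hxy) _ hm h₁
  · exact hval x hx y hy hxy m hm hm'

/-! ### Evaluation of the methods of the library -/

/-- The body of the absolute value. -/
def absRest : Tm :=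
  .ite (.op .lt (.var vz) (.int 0)) (.op .sub (.int 0) (.var vz)) (.var vz)

/-- The lookup `(!F) i`. -/
def lookupAt (i : ℤ) : Tm := .letin vf (.deref refF) (.appVar vf (.int i))

/-- The critical section of `upd_r (i, g, j)`, without the acquisition of the lock; `Y` is the new
multiplicity. -/
def updRRest (i : ℤ) (g : Meth) (j : ℤ) (Y : Tm) : Tm :=
  .letin vf (.deref refF) <|
  .ite (.op .eq (.int j) (.appVar vf (.int i)))
    (.seq (.assign refF (.lam vx .int
      (.ite (.op .eq (.var vx) (.int i)) Y (.appVar vf (.var vx))))) (.seq (.release lockRef) Y))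
    (.seq (.release lockRef) (.letin vu (.deref updR)
      (.appVar vu (.pair (.int i) (.pair (.meth g) (.appVar vf (.int i)))))))

/-- The context in which `upd_r (i, g, j)` calls `g`. -/
def argCtx (i : ℤ) (g : Meth) (j : ℤ) : ECtx :=
  .letin vy (.letin vz .hole absRest) (.seq (.acquire lockRef) (updRRest i g j (.var vy)))

/-- The part of `update_enc i` that follows the call of `foo`; `Y` is the new multiplicity. -/
def updateEncRest (i : ℤ) (Y : Tm) : Tm :=
  .letin vf (.deref refF) <|
  .seq (.assign refF (.lam vx .int
    (.ite (.op .eq (.var vx) (.int i)) Y (.appVar vf (.var vx))))) (.seq (.release lockRef) Y)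

/-- The context in which `update_enc i` calls `foo`. -/
def fooCtx (i : ℤ) : ECtx :=
  .letin vy (.letin vz .hole absRest) (updateEncRest i (.var vy))

/-- The update of `F` to the value `y` at `i`, followed by the release of the lock. -/
def storeTm (i y : ℤ) (f : Meth) : Tm :=
  .seq (.assign refF (.lam vx .int (updatedBody i y f))) (.seq (.release lockRef) (.int y))

/-- The recursive call `upd_r (i, g, f i)`. -/
def recurse (i : ℤ) (g f : Meth) : Tm :=
  .letin vu (.deref updR) (.appVar vu (.pair (.int i) (.pair (.meth g) (.appMeth f (.int i)))))

section Evaluation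

variable {u : Meth} {R : Repo}

theorem detSteps_updateBody (i : ℤ) (g : Meth) :
    DetSteps u R (updateBody.subst vp (.pair (.int i) (.meth g)))
      (.appMeth u (.pair (.int i) (.pair (.meth g) (lookupAt i)))) :=
  .head rfl <| .head rfl <| .head rfl <| .head rfl <| .head rfl <| .head rfl .refl

theorem detSteps_lookup {f : Meth} {φ : ℤ → ℤ} (hf : Represents u R f φ) (E : ECtx) (i : ℤ) :
    DetSteps u R (E.plug (.letin vf (.meth f) (.appVar vf (.int i)))) (E.plug (.int (φ i))) :=
  .head (detStep_plug E (r' := .appMeth f (.int i)) rfl rfl) (hf E i)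

/-- The evaluation of `upd_r (i, g, j)` up to the call of `g`. -/
theorem detSteps_updR (hu : R u = some (vp, updRBody)) (i : ℤ) (g : Meth) (j : ℤ) :
    DetSteps u R (.appMeth u (.pair (.int i) (.pair (.meth g) (.int j))))
      ((argCtx i g j).plug (.appMeth g (.int j))) := by
  have h : detStep u R (.appMeth u (.pair (.int i) (.pair (.meth g) (.int j)))) =
      some (updRBody.subst vp (.pair (.int i) (.pair (.meth g) (.int j)))) := by
    refine (detStep_plug .hole (isRedex_appMeth u (.pair (.int i) (.pair (.meth g) (.int j))))
      (r' := updRBody.subst vp (.pair (.int i) (.pair (.meth g) (.int j)))) ?_)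
    simp [detHead, hu, Tm.toVal?]
  refine .head h ?_
  exact .head rfl <| .head rfl <| .head rfl <| .head rfl <| .head rfl <| .head rfl <| .head rfl <|
    .head rfl .refl

theorem detSteps_updR_lookup (hu : R u = some (vp, updRBody)) {f : Meth} {φ : ℤ → ℤ}
    (hf : Represents u R f φ) (i : ℤ) (g : Meth) :
    DetSteps u R (.appMeth u (.pair (.int i) (.pair (.meth g)
      (.letin vf (.meth f) (.appVar vf (.int i))))))
      ((argCtx i g (φ i)).plug (.appMeth g (.int (φ i)))) :=
  (detSteps_lookup hf (.appMeth u (.pairR (.int i) (.pairR (.meth g) .hole))) i).trans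
    (detSteps_updR hu i g (φ i))

theorem detSteps_recurse (hu : R u = some (vp, updRBody)) {f : Meth} {φ : ℤ → ℤ}
    (hf : Represents u R f φ) (i : ℤ) (g : Meth) :
    DetSteps u R (recurse i g f) ((argCtx i g (φ i)).plug (.appMeth g (.int (φ i)))) :=
  .head rfl <| .head rfl <|
    (hf (.appMeth u (.pairR (.int i) (.pairR (.meth g) .hole))) i).trans
      (detSteps_updR hu i g (φ i))

theorem detSteps_abs (E : ECtx) (j : ℤ) :
    DetSteps u R (E.plug (.letin vz (.int j) absRest)) (E.plug (.int |j|)) := by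
  refine .head (detStep_plug E (r' := .ite (.op .lt (.int j) (.int 0))
    (.op .sub (.int 0) (.int j)) (.int j)) rfl rfl) ?_
  have h := detStep_plug (u := u) (R := R)
    (E.comp (.ite .hole (.op .sub (.int 0) (.int j)) (.int j)))
    (r := .op .lt (.int j) (.int 0)) (r' := .int (Op.eval .lt j 0)) rfl rfl
  simp only [ECtx.plug_comp, ECtx.plug] at h
  refine .head h ?_
  by_cases hj : j < 0
  · refine .head (detStep_plug E (r' := .op .sub (.int 0) (.int j)) rfl
      (by simp [detHead, Op.eval, hj])) ?_
    refine .head (detStep_plug E (r' := .int (0 - j)) rfl rfl) ?_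
    rw [abs_of_neg hj, zero_sub]
    exact .refl
  · refine .head (detStep_plug E (r' := .int j) rfl (by simp [detHead, Op.eval, hj])) ?_
    rw [abs_of_nonneg (not_lt.1 hj)]
    exact .refl

theorem detSteps_argCtx (i : ℤ) (g : Meth) (j k : ℤ) :
    DetSteps u R ((argCtx i g j).plug (.int k))
      (.seq (.acquire lockRef) (updRRest i g j (.int |k|))) :=
  (detSteps_abs (.letin vy .hole (.seq (.acquire lockRef) (updRRest i g j (.var vy)))) k).trans
    (.head rfl .refl)

theorem detSteps_fooCtx (i k : ℤ) :
    DetSteps u R ((fooCtx i).plug (.int k)) (updateEncRest i (.int |k|)) :=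
  (detSteps_abs (.letin vy .hole (updateEncRest i (.var vy))) k).trans (.head rfl .refl)

/-- The comparison in the critical section of `upd_r`. -/
theorem detSteps_updRRest {f : Meth} {φ : ℤ → ℤ} (hf : Represents u R f φ) (i : ℤ) (g : Meth)
    (j y : ℤ) :
    DetSteps u R ((ECtx.letin vf .hole (.ite (.op .eq (.int j) (.appVar vf (.int i)))
      (.seq (.assign refF (.lam vx .int
        (.ite (.op .eq (.var vx) (.int i)) (.int y) (.appVar vf (.var vx)))))
          (.seq (.release lockRef) (.int y)))
      (.seq (.release lockRef) (.letin vu (.deref updR)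
        (.appVar vu (.pair (.int i) (.pair (.meth g) (.appVar vf (.int i))))))))).plug (.meth f))
      (if j = φ i then storeTm i y f else .seq (.release lockRef) (recurse i g f)) := by
  refine .head rfl ?_
  refine (hf (.ite (.opR .eq j .hole) (storeTm i y f)
    (.seq (.release lockRef) (recurse i g f))) i).trans ?_
  refine .head rfl ?_
  refine .head (detStep_plug .hole (r' := if j = φ i then storeTm i y f else
    .seq (.release lockRef) (recurse i g f)) rfl ?_) .refl
  by_cases h : j = φ i <;> simp [detHead, Op.eval, h, ECtx.plug]

theorem detSteps_seq (M : Tm) : DetSteps u R (.letin 1000 .unit (.seq (.release lockRef) M))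
    (.seq (.release lockRef) M) :=
  .head rfl .refl

end Evaluation

theorem count_setMult (I : Multiset ℤ) (i : ℤ) {y : ℤ} (hy : 0 ≤ y) :
    (fun k => ((setMult I i y.natAbs).count k : ℤ)) =
      Function.update (fun k => (I.count k : ℤ)) i y := by
  funext k
  by_cases hk : k = i
  · subst hk
    simp [setMult, hy]
  · simp [setMult, hk, Multiset.count_replicate, Ne.symm hk]

/-! ### The invariant of a thread -/

/-- The evaluation stack of a thread with the given unanswered calls of arguments of `update`. -/
def stackOf : List Frame → List Item
  | [] => []
  | F :: fs => .meth F.g :: .ctx (argCtx F.i F.g (F.I.count F.i)) :: .meth update :: stackOf fs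

/-- The methods of the frames belong to `G` and return integers. -/
def FramesIn (G : Set Meth) (fs : List Frame) : Prop :=
  ∀ F ∈ fs, F.g ∈ G ∧ F.g.res = .int

theorem FramesIn.mono {G G' : Set Meth} (hG : G ⊆ G') {fs : List Frame} (h : FramesIn G fs) :
    FramesIn G' fs := fun F hF => ⟨hG (h F hF).1, (h F hF).2⟩

theorem FramesIn.tail {G : Set Meth} {F : Frame} {fs : List Frame} (h : FramesIn G (F :: fs)) :
    FramesIn G fs := fun F' hF => h F' (List.mem_cons_of_mem _ hF)

/-- A thread, with the given stack and term, that is about to play a `P`-move which is already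
part of its word `w`. The flag says whether the thread holds the lock. -/
inductive Emit (t : ℕ) (G : Set Meth) (cur : Multiset ℤ) :
    List Item → Tm → List XMove → Bool → Act → Prop
  | ret (m : Meth) (y : ℤ) (fs : List Frame) (w : List XMove) : FramesIn G fs → Partial t fs w →
      Emit t G cur (.meth m :: stackOf fs) (.int y) w false ⟨.ret, m, .int y, .P, .K⟩
  | callArg (F : Frame) (fs : List Frame) (w : List XMove) : FramesIn G (F :: fs) →
      Partial t (F :: fs) w →
      Emit t G cur (.meth update :: stackOf fs)
        ((argCtx F.i F.g (F.I.count F.i)).plug (.appMeth F.g (.int (F.I.count F.i)))) w false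
        ⟨.call, F.g, .int (F.I.count F.i), .P, .K⟩
  | callFoo (i : ℤ) (fs : List Frame) (w : List XMove) : FramesIn G fs → Partial t fs w →
      Emit t G cur (.meth updateEnc :: stackOf fs)
        ((fooCtx i).plug (.appMeth foo (.int (cur.count i))))
        (w ++ [xcall t updateEnc (.int i) .O .K cur, xcall t foo (.int (cur.count i)) .P .L cur])
        true ⟨.call, foo, .int (cur.count i), .P, .L⟩

/-- The states of a thread in which its next transition depends on or changes the shared state.
The arguments are its stack, its term, its moves in the linearisation, whether it holds the lock,
the `O`-move that it has played and that is not part of the linearisation, and the `P`-move that is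
part of the linearisation and that it has not played. The method `f` is the contents of `F` and
`cur` the current multiset. -/
inductive Stuck (t : ℕ) (u : Meth) (R : Repo) (G : Set Meth) (f : Meth) (cur : Multiset ℤ) :
    List Item → Tm → List XMove → Bool → List Act → List Act → Prop
  | countRead (i : ℤ) (fs : List Frame) (w : List XMove) : FramesIn G fs → Partial t fs w →
      Stuck t u R G f cur (.meth count :: stackOf fs) (lookupAt i) w false
        [⟨.call, count, .int i, .O, .K⟩] []
  | updateRead (i : ℤ) (g : Meth) (fs : List Frame) (w : List XMove) :
      g ∈ G ∧ g.res = .int → FramesIn G fs → Partial t fs w →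
      Stuck t u R G f cur (.meth update :: stackOf fs)
        (.appMeth u (.pair (.int i) (.pair (.meth g) (lookupAt i)))) w false
        [⟨.call, update, .pair (.int i) (.meth g), .O, .K⟩] []
  | encAcquire (i : ℤ) (fs : List Frame) (w : List XMove) : FramesIn G fs → Partial t fs w →
      Stuck t u R G f cur (.meth updateEnc :: stackOf fs)
        (.seq (.acquire lockRef) ((fooCtx i).plug (.appMeth foo (lookupAt i)))) w false
        [⟨.call, updateEnc, .int i, .O, .K⟩] []
  | encRead (i : ℤ) (fs : List Frame) (w : List XMove) : FramesIn G fs → Partial t fs w →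
      Stuck t u R G f cur (.meth updateEnc :: stackOf fs)
        ((fooCtx i).plug (.appMeth foo (lookupAt i))) w true
        [⟨.call, updateEnc, .int i, .O, .K⟩] []
  | updateAcquire (F : Frame) (j : ℤ) (fs : List Frame) (w : List XMove) : FramesIn G (F :: fs) →
      Partial t (F :: fs) w →
      Stuck t u R G f cur (.meth update :: stackOf fs)
        (.seq (.acquire lockRef) (updRRest F.i F.g (F.I.count F.i) (.int |j|))) w false
        [⟨.ret, F.g, .int j, .O, .K⟩] []
  | updateCompare (F : Frame) (j : ℤ) (fs : List Frame) (w : List XMove) : FramesIn G (F :: fs) →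
      Partial t (F :: fs) w →
      Stuck t u R G f cur (.meth update :: stackOf fs)
        (updRRest F.i F.g (F.I.count F.i) (.int |j|)) w true
        [⟨.ret, F.g, .int j, .O, .K⟩] []
  | encReread (i j : ℤ) (fs : List Frame) (w : List XMove) : FramesIn G fs → Partial t fs w →
      Stuck t u R G f cur (.meth updateEnc :: stackOf fs) (updateEncRest i (.int |j|))
        (w ++ [xcall t updateEnc (.int i) .O .K cur, xcall t foo (.int (cur.count i)) .P .L cur])
        true [⟨.ret, foo, .int j, .O, .L⟩] []
  | alloc (m : Meth) (i y : ℤ) (o : Act) (fs : List Frame) (w : List XMove) : 0 ≤ y → o.who = .O → FramesIn G fs →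
      Partial t fs (w ++ [(⟨t, o⟩, cur), xret t m (.int y) .P .K (setMult cur i y.natAbs)]) →
      Stuck t u R G f cur (.meth m :: stackOf fs) (storeTm i y f) w true [o] []
  | store (m n : Meth) (i y : ℤ) (o : Act) (fs : List Frame) (w : List XMove) : 0 ≤ y → o.who = .O → FramesIn G fs →
      Partial t fs (w ++ [(⟨t, o⟩, cur), xret t m (.int y) .P .K (setMult cur i y.natAbs)]) →
      R n = some (vx, updatedBody i y f) →
      Stuck t u R G f cur (.meth m :: stackOf fs)
        (.seq (.assign refF (.meth n)) (.seq (.release lockRef) (.int y))) w true [o] []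
  | release (stk : List Item) (M N : Tm) (w : List XMove) (p : Act) : Emit t G cur stk N w false p →
      DetSteps u R (M.subst 1000 .unit) N →
      Stuck t u R G f cur stk (.seq (.release lockRef) M) w true [] [p]
  | emit (stk : List Item) (N : Tm) (w : List XMove) (b : Bool) (p : Act) :
      Emit t G cur stk N w b p → Stuck t u R G f cur stk N w b [] [p]

/-- The states of a thread: waiting for a move of the client, waiting for the return of `foo`
in a call of `update_enc`, and evaluating deterministically to a state in `Stuck`. -/
inductive ThreadInv (t : ℕ) (u : Meth) (R : Repo) (G : Set Meth) (f : Meth) (cur : Multiset ℤ) :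
    Comp → List XMove → Bool → List Act → List Act → Prop
  | idle (stk : List Item) (fs : List Frame) (w : List XMove) : stk = stackOf fs → FramesIn G fs →
      Partial t fs w → ThreadInv t u R G f cur ⟨stk, none⟩ w false [] []
  | inFoo (i : ℤ) (fs : List Frame) (w : List XMove) : FramesIn G fs → Partial t fs w →
      ThreadInv t u R G f cur ⟨.meth foo :: .ctx (fooCtx i) :: .meth updateEnc :: stackOf fs, none⟩
        (w ++ [xcall t updateEnc (.int i) .O .K cur, xcall t foo (.int (cur.count i)) .P .L cur])
        true [] []
  | run (stk : List Item) (M N : Tm) (w : List XMove) (b : Bool) (pO pP : List Act) :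
      DetSteps u R M N → Stuck t u R G f cur stk N w b pO pP →
      ThreadInv t u R G f cur ⟨stk, some M⟩ w b pO pP

section Mono

variable {t : ℕ} {u f f' : Meth} {R R' : Repo} {G G' : Set Meth} {cur cur' : Multiset ℤ}
  {stk : List Item} {N : Tm} {w : List XMove} {b : Bool} {p : Act} {pO pP : List Act} {C : Comp}

theorem Emit.mono (hG : G ⊆ G') (hb : b = false ∨ cur' = cur) (h : Emit t G cur stk N w b p) :
    Emit t G' cur' stk N w b p := by
  cases h with
  | ret m y fs w h₁ h₂ => exact .ret m y fs w (h₁.mono hG) h₂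
  | callArg F fs w h₁ h₂ => exact .callArg F fs w (h₁.mono hG) h₂
  | callFoo i fs w h₁ h₂ =>
    obtain rfl : cur' = cur := by simpa using hb
    exact .callFoo i fs w (h₁.mono hG) h₂

/-- The states of a thread that does not hold the lock are insensitive to the contents of `F`. -/
theorem Stuck.mono (hR : R.Le R') (hG : G ⊆ G') (hb : b = false ∨ f' = f ∧ cur' = cur)
    (h : Stuck t u R G f cur stk N w b pO pP) : Stuck t u R' G' f' cur' stk N w b pO pP := by
  cases h with
  | countRead i fs w h₁ h₂ => exact .countRead i fs w (h₁.mono hG) h₂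
  | updateRead i g fs w h h₁ h₂ => exact .updateRead i g fs w ⟨hG h.1, h.2⟩ (h₁.mono hG) h₂
  | encAcquire i fs w h₁ h₂ => exact .encAcquire i fs w (h₁.mono hG) h₂
  | encRead i fs w h₁ h₂ => exact .encRead i fs w (h₁.mono hG) h₂
  | updateAcquire F j fs w h₁ h₂ => exact .updateAcquire F j fs w (h₁.mono hG) h₂
  | updateCompare F j fs w h₁ h₂ => exact .updateCompare F j fs w (h₁.mono hG) h₂
  | encReread i j fs w h₁ h₂ =>
    obtain ⟨rfl, rfl⟩ : f' = f ∧ cur' = cur := by simpa using hb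
    exact .encReread i j fs w (h₁.mono hG) h₂
  | alloc m i y o fs w h₃ h₄ h₅ h₆ =>
    obtain ⟨rfl, rfl⟩ : f' = f ∧ cur' = cur := by simpa using hb
    exact .alloc m i y o fs w h₃ h₄ (h₅.mono hG) h₆
  | store m n i y o fs w h₃ h₄ h₅ h₆ h₇ =>
    obtain ⟨rfl, rfl⟩ : f' = f ∧ cur' = cur := by simpa using hb
    exact .store m n i y o fs w h₃ h₄ (h₅.mono hG) h₆ (hR _ _ h₇)
  | release stk M N w p h₁ h₂ => exact .release stk M N w p (h₁.mono hG (.inl rfl)) (h₂.mono hR)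
  | emit stk N w b p h₁ => exact .emit stk N w b p (h₁.mono hG (hb.imp_right And.right))

theorem ThreadInv.mono (hR : R.Le R') (hG : G ⊆ G') (hb : b = false ∨ f' = f ∧ cur' = cur)
    (h : ThreadInv t u R G f cur C w b pO pP) : ThreadInv t u R' G' f' cur' C w b pO pP := by
  cases h with
  | idle stk fs w h₁ h₂ h₃ => exact .idle stk fs w h₁ (h₂.mono hG) h₃
  | inFoo i fs w h₁ h₂ =>
    obtain ⟨rfl, rfl⟩ : f' = f ∧ cur' = cur := by simpa using hb
    exact .inFoo i fs w (h₁.mono hG) h₂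
  | run stk M N w b pO pP h₁ h₂ => exact .run stk M N w b pO pP (h₁.mono hR) (h₂.mono hR hG hb)

end Mono

/-- The invariant of the shared components of a configuration: `u` is the contents of `updR`, `f`
that of `F`, and `cur` the multiset that `f` represents. -/
structure EnvInv (u f : Meth) (cur : Multiset ℤ) (e : Env) : Prop where
  countDef : e.R count = some (vi, countBody)
  updateDef : e.R update = some (vp, updateBody)
  updateEncDef : e.R updateEnc = some (vi, updateEncBody)
  updDef : e.R u = some (vp, updRBody)
  refUDef : e.S updR = some (.meth u)
  refFDef : e.S refF = some (.meth f)
  rep : Represents u e.R f fun k => (cur.count k : ℤ)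
  pub : e.P = onlyOn .K pubMeths
  absL : e.A .L = {foo}
  absK : ∀ m ∈ e.A .K, m ∉ baseMeths
  absR : ∀ Y, ∀ m ∈ e.A Y, e.R m = none

theorem EnvInv.of_le {u f f' : Meth} {cur cur' : Multiset ℤ} {e : Env} (h : EnvInv u f cur e)
    {R : Repo} {S : Store} (hR : e.R.Le R) (hA : ∀ m, e.R m = none → R m ≠ none → ∀ Y, m ∉ e.A Y)
    (hU : S updR = e.S updR) (hF : S refF = some (.meth f'))
    (hrep : Represents u R f' fun k => (cur'.count k : ℤ)) :
    EnvInv u f' cur' { e with R := R, S := S } where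
  countDef := hR _ _ h.countDef
  updateDef := hR _ _ h.updateDef
  updateEncDef := hR _ _ h.updateEncDef
  updDef := hR _ _ h.updDef
  refUDef := hU.trans h.refUDef
  refFDef := hF
  rep := hrep
  pub := h.pub
  absL := h.absL
  absK := h.absK
  absR := fun Y m hm => by
    by_contra hn
    exact hA m (h.absR Y m hm) hn Y hm

/-- The effect of an internal step on the lock and on the flag that says whether the thread
holds it. -/
def LockChange (S S' : Store) (b b' : Bool) : Prop :=
  (b' = b ∧ S' lockRef = S lockRef) ∨
  (b = false ∧ b' = true ∧ S lockRef = some (.int 0) ∧ S' lockRef = some (.int 1)) ∨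
  (b = true ∧ b' = false ∧ S' lockRef = some (.int 0))

/-- The effect of an internal step on the linearisation: none, or the pending `O`-move and
the `P`-move that answers it are appended. -/
inductive LinChange (t : ℕ) (cur : Multiset ℤ) : Multiset ℤ → List XMove → List XMove →
    List Act → List Act → List Act → List Act → Prop
  | silent (w : List XMove) (pO pP : List Act) : LinChange t cur cur w w pO pO pP pP
  | point (cur' : Multiset ℤ) (w : List XMove) (o p : Act) : o.who = .O → p.who = .P →
      LinChange t cur cur' w (w ++ [(⟨t, o⟩, cur), (⟨t, p⟩, cur')]) [o] [] [] [p]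

section IntStep

variable {t : ℕ} {u f : Meth} {cur : Multiset ℤ} {e : Env} {stk : List Item} {N M' : Tm}
  {w : List XMove} {b : Bool} {pO pP : List Act} {R' : Repo} {S' : Store}

/-- The possible results of an internal step. -/
def StepResult (t : ℕ) (u f : Meth) (cur : Multiset ℤ) (e e₁ : Env) (D : Comp) (w : List XMove)
    (b : Bool) (pO pP : List Act) : Prop :=
  ∃ f' cur' w' b' pO' pP', EnvInv u f' cur' e₁ ∧
    ThreadInv t u e₁.R (e₁.A .K) f' cur' D w' b' pO' pP' ∧ e.R.Le e₁.R ∧ e₁.A = e.A ∧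
    LockChange e.S e₁.S b b' ∧ (b = true ∨ f' = f ∧ cur' = cur) ∧
    LinChange t cur cur' w w' pO pO' pP pP'

/-- Reductions that depend on or change the shared state. -/
theorem Stuck.step (hE : EnvInv u f cur e) (h : Stuck t u e.R (e.A .K) f cur stk N w b pO pP)
    (hs : TStep t (N, e.R, e.S) (M', R', S'))
    (hA : ∀ m, e.R m = none → R' m ≠ none → ∀ Y, m ∉ e.A Y) :
    StepResult t u f cur e { e with R := R', S := S' } ⟨stk, some M'⟩ w b pO pP := by
  obtain ⟨E, r, r', hd, rfl, hs⟩ := hs.exists_headStep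
  have hself : EnvInv u f cur { e with R := e.R, S := e.S } := hE
  have hread : ∀ {v : Val}, e.S refF = some v → v = .meth f := fun {v} h => by
    rw [hE.refFDef] at h
    cases h
    rfl
  cases h with
  | countRead i fs w h₁ h₂ =>
    cases hd
    cases hs with
    | deref _ _ _ v hv =>
      obtain rfl := hread hv
      refine ⟨f, cur, _, false, [], _, hself, .run _ _ _ _ _ _ _ (detSteps_lookup hE.rep .hole i)
        (.emit _ _ _ _ _ (.ret count _ fs _ h₁ ?_)), Repo.le_refl _, rfl,
        .inl ⟨rfl, rfl⟩, .inr ⟨rfl, rfl⟩, .point cur w _ _ rfl rfl⟩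
      exact h₂.append (.count i cur [] .nil)
  | updateRead i g fs w h h₁ h₂ =>
    cases hd
    cases hs with
    | deref _ _ _ v hv =>
      obtain rfl := hread hv
      refine ⟨f, cur, _, false, [], _, hself, .run _ _ _ _ _ _ _
        (detSteps_updR_lookup hE.updDef hE.rep i g)
        (.emit _ _ _ _ _ (.callArg ⟨i, g, cur⟩ fs _ ?_ (h₂.openUpdate i g cur))), Repo.le_refl _,
        rfl, .inl ⟨rfl, rfl⟩, .inr ⟨rfl, rfl⟩, .point cur w _ _ rfl rfl⟩
      intro F hF
      rcases List.mem_cons.1 hF with rfl | hF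
      · exact h
      · exact h₁ F hF
  | encAcquire i fs w h₁ h₂ =>
    cases hd
    cases hs with
    | acquire _ _ _ hv =>
      refine ⟨f, cur, w, true, _, _, hE.of_le (Repo.le_refl _) hA ?_ ?_ hE.rep,
        .run _ _ _ _ _ _ _ (.head rfl .refl) (.encRead i fs w h₁ h₂), Repo.le_refl _, rfl,
        .inr (.inl ⟨rfl, rfl, hv, ?_⟩), .inr ⟨rfl, rfl⟩, .silent ..⟩
      · exact Function.update_of_ne (show _ ≠ _ by decide) _ e.S
      · exact (Function.update_of_ne (show refF ≠ lockRef by decide) _ e.S).trans hE.refFDef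
      · exact Function.update_self lockRef _ e.S
  | encRead i fs w h₁ h₂ =>
    cases hd
    cases hs with
    | deref _ _ _ v hv =>
      obtain rfl := hread hv
      exact ⟨f, cur, _, true, [], _, hself, .run _ _ _ _ _ _ _
        (detSteps_lookup hE.rep (.letin vy (.letin vz (.appMeth foo .hole) absRest)
          (updateEncRest i (.var vy))) i)
        (.emit _ _ _ _ _ (.callFoo i fs _ h₁ h₂)), Repo.le_refl _, rfl,
        .inl ⟨rfl, rfl⟩, .inr ⟨rfl, rfl⟩, .point cur w _ _ rfl rfl⟩
  | updateAcquire F j fs w h₁ h₂ =>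
    cases hd
    cases hs with
    | acquire _ _ _ hv =>
      refine ⟨f, cur, w, true, _, _, hE.of_le (Repo.le_refl _) hA ?_ ?_ hE.rep,
        .run _ _ _ _ _ _ _ (.head rfl .refl) (.updateCompare F j fs w h₁ h₂), Repo.le_refl _, rfl,
        .inr (.inl ⟨rfl, rfl, hv, ?_⟩), .inr ⟨rfl, rfl⟩, .silent ..⟩
      · exact Function.update_of_ne (show _ ≠ _ by decide) _ e.S
      · exact (Function.update_of_ne (show refF ≠ lockRef by decide) _ e.S).trans hE.refFDef
      · exact Function.update_self lockRef _ e.S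
  | updateCompare F j fs w h₁ h₂ =>
    cases hd
    cases hs with
    | deref _ _ _ v hv =>
      obtain rfl := hread hv
      have hsteps := detSteps_updRRest hE.rep F.i F.g (F.I.count F.i) |j|
      by_cases hj : F.I.count F.i = cur.count F.i
      · rw [if_pos (by exact_mod_cast hj)] at hsteps
        refine ⟨f, cur, w, true, _, _, hself, .run _ _ _ _ _ _ _ hsteps
          (.alloc update F.i |j| _ fs w (abs_nonneg j) rfl h₁.tail ?_),
          Repo.le_refl _, rfl, .inl ⟨rfl, rfl⟩, .inr ⟨rfl, rfl⟩, .silent ..⟩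
        rw [Int.natAbs_abs]
        exact h₂.closeUpdate j cur hj
      · rw [if_neg (by exact_mod_cast hj)] at hsteps
        refine ⟨f, cur, _, true, [], _, hself, .run _ _ _ _ _ _ _ hsteps
          (.release _ _ _ _ _ (.callArg ⟨F.i, F.g, cur⟩ fs _ ?_ (h₂.retry j cur hj))
            (detSteps_recurse hE.updDef hE.rep F.i F.g)), Repo.le_refl _,
          rfl, .inl ⟨rfl, rfl⟩, .inr ⟨rfl, rfl⟩, .point cur w _ _ rfl rfl⟩
        intro F' hF
        rcases List.mem_cons.1 hF with rfl | hF
        · exact h₁ F (by simp)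
        · exact h₁.tail F' hF
  | encReread i j fs w h₁ h₂ =>
    cases hd
    cases hs with
    | deref _ _ _ v hv =>
      obtain rfl := hread hv
      refine ⟨f, cur, _, true, _, _, hself, .run _ _ _ _ _ _ _ (.head rfl .refl)
          (.alloc updateEnc i |j| _ fs _ (abs_nonneg j) rfl h₁ ?_),
          Repo.le_refl _, rfl, .inl ⟨rfl, rfl⟩, .inr ⟨rfl, rfl⟩, .silent ..⟩
      rw [Int.natAbs_abs, List.append_assoc]
      exact h₂.append (.updateEnc i j cur [] .nil)
  | alloc m i y o fs w h₃ h₄ h₅ h₆ =>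
    cases hd
    cases hs with
    | lam _ _ _ _ _ n hn =>
      refine ⟨f, cur, w, true, _, _, hE.of_le (Repo.le_update hn _) hA rfl hE.refFDef
        (hE.rep.mono (Repo.le_update hn _)), .run _ _ _ _ _ _ _ .refl
        (.store m n i y o fs w h₃ h₄ h₅ h₆ (Function.update_self ..)), Repo.le_update hn _,
        rfl, .inl ⟨rfl, rfl⟩, .inr ⟨rfl, rfl⟩, .silent ..⟩
  | store m n i y o fs w h₃ h₄ h₅ h₆ h₇ =>
    cases hd
    generalize hv : Tm.assign refF (.meth n) = r at hs
    cases hs with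
    | assign _ _ _ v =>
      simp only [Tm.assign.injEq] at hv
      obtain ⟨rfl, hv⟩ := hv
      obtain rfl : v = .meth n := by
        have := congrArg Tm.toVal? hv
        rw [Val.toVal?_toTm] at this
        exact (Option.some.inj this).symm
      refine ⟨n, setMult cur i y.natAbs, _, true, [], _, hE.of_le (Repo.le_refl _) hA ?_
        (Function.update_self ..) ?_, .run _ _ _ _ _ _ _ (detSteps_seq _)
        (.release _ _ _ _ _ (.ret m y fs _ h₅ h₆) .refl), Repo.le_refl _, rfl,
        .inl ⟨rfl, ?_⟩, .inl rfl, .point _ w o _ h₄ rfl⟩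
      · exact Function.update_of_ne (show updR ≠ refF by decide) (some (.meth n)) e.S
      · rw [count_setMult _ _ h₃]
        exact represents_update hE.rep h₇
      · exact Function.update_of_ne (show lockRef ≠ refF by decide) (some (.meth n)) e.S
    | _ => simp at hv
  | release stk M N w p h₁ h₂ =>
    cases hd
    cases hs with
    | release =>
      refine ⟨f, cur, w, false, _, _, hE.of_le (Repo.le_refl _) hA ?_ ?_ hE.rep,
        .run _ _ _ _ _ _ _ (.head rfl h₂) (.emit _ _ _ _ _ h₁), Repo.le_refl _, rfl,
        .inr (.inr ⟨rfl, rfl, ?_⟩), .inr ⟨rfl, rfl⟩, .silent ..⟩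
      · exact Function.update_of_ne (show _ ≠ _ by decide) _ e.S
      · exact (Function.update_of_ne (show refF ≠ lockRef by decide) _ e.S).trans hE.refFDef
      · exact Function.update_self lockRef _ e.S
  | emit stk N w b p h₁ =>
    exfalso
    -- values do not reduce, and abstract methods have no bodies
    have happ : ∀ {m : Meth} {k : ℤ}, e.R m = none →
        ¬ HeadStep t (.appMeth m (.int k), e.R, e.S) (r', R', S') := by
      intro m k hm h
      generalize hv : Tm.appMeth m (.int k) = r at h
      cases h with
      | app _ _ n v x B hn =>
        simp only [Tm.appMeth.injEq] at hv
        obtain ⟨rfl, -⟩ := hv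
        simp [hm] at hn
      | _ => simp at hv
    cases h₁ with
    | ret m y fs w => cases hd
    | callArg F fs w h₁ =>
      rw [ECtx.decomp_plug (r := .appMeth F.g (.int _)) rfl] at hd
      cases hd
      exact happ (hE.absR _ _ (h₁ F (by simp)).1) hs
    | callFoo i fs w h₁ =>
      rw [ECtx.decomp_plug (r := .appMeth foo (.int _)) rfl] at hd
      cases hd
      exact happ (hE.absR .L foo (by simp [hE.absL])) hs

theorem ThreadInv.intStep {C D : Comp} {e₁ : Env} (hE : EnvInv u f cur e)
    (h : ThreadInv t u e.R (e.A .K) f cur C w b pO pP) (hs : IntStep t C e D e₁) :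
    StepResult t u f cur e e₁ D w b pO pP := by
  cases hs with
  | int 𝓔 e M M' R' S' hs hA =>
    cases h with
    | run stk M N w b pO pP hd h =>
      rcases hs.detSteps_cases hE.refUDef hd with ⟨hd', rfl, rfl⟩ | rfl
      · exact ⟨f, cur, w, b, pO, pP, hE, .run _ _ _ _ _ _ _ hd' h, Repo.le_refl _, rfl,
          .inl ⟨rfl, rfl⟩, .inr ⟨rfl, rfl⟩, .silent ..⟩
      · exact h.step hE hs fun m h₁ h₂ => (hA m h₁ h₂).2

end IntStep

/-! ### External transitions -/

theorem passOut_int {Y : Side} {e e' : Env} {k : ℤ} {v : Val} (h : PassOut Y e (.int k) v e') :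
    v = .int k ∧ e' = e := by
  obtain ⟨ρ, -, -, rfl, -, h₁, h₂, h₃, h₄⟩ := h
  refine ⟨rfl, ?_⟩
  have h₅ : e'.R = e.R := funext fun n => h₁ n (by simp [Val.names])
  have h₆ : e'.P = e.P := by
    rw [h₂]
    simp [addNames, Val.names]
  cases e
  cases e'
  simp_all

theorem passIn_of_names_eq_empty {Y : Side} {e e' : Env} {v : Val} (hv : v.names = ∅)
    (h : PassIn Y e v e') : e' = e := by
  obtain ⟨-, rfl⟩ := h
  simp [addNames, hv]

theorem Val.eq_int_of_ty {v : Val} (h : v.ty = .int) : ∃ k, v = .int k := by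
  cases v <;> simp_all [Val.ty]

theorem Val.eq_of_toTm_eq_int {v : Val} {k : ℤ} (h : v.toTm = .int k) : v = .int k := by
  have := congrArg Tm.toVal? h
  rw [Val.toVal?_toTm] at this
  exact Option.some.inj this

theorem EnvInv.side_eq_K {u f : Meth} {cur : Multiset ℤ} {e : Env} (hE : EnvInv u f cur e)
    {m : Meth} {Y : Side} (h : m ∈ e.P Y) : Y = .K ∧ m ∈ pubMeths := by
  rw [hE.pub] at h
  cases Y
  · exact ⟨rfl, by simpa [onlyOn, addNames] using h⟩
  · simp [onlyOn, addNames] at h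

theorem EnvInv.side_eq_of_mem {u f : Meth} {cur : Multiset ℤ} {e : Env} (hE : EnvInv u f cur e)
    {g : Meth} (hg : g ∈ e.A .K) {Y : Side} (h : g ∈ e.A Y) : Y = .K := by
  cases Y
  · rfl
  · rw [hE.absL] at h
    obtain rfl := h
    exact absurd hg fun h => hE.absK _ h (by simp [baseMeths])

theorem EnvInv.side_foo {u f : Meth} {cur : Multiset ℤ} {e : Env} (hE : EnvInv u f cur e)
    {Y : Side} (h : foo ∈ e.A Y) : Y = .L := by
  cases Y
  · exact absurd (by simp [baseMeths]) (hE.absK _ h)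
  · rfl

/-- The names that the client passes are fresh, hence not those of the interface. -/
theorem EnvInv.passIn {u f : Meth} {cur : Multiset ℤ} {e e' : Env} {v : Val}
    (hE : EnvInv u f cur e) (h : PassIn .K e v e') : EnvInv u f cur e' ∧ e'.R = e.R ∧ e'.S = e.S ∧
      e'.A .K = e.A .K ∪ (v.names : Set Meth) ∧ ∀ m ∈ v.names, m ∉ baseMeths := by
  obtain ⟨h, rfl⟩ := h
  have hb : ∀ m ∈ v.names, m ∉ baseMeths := by
    intro m hm hb
    obtain ⟨h₁, h₂, -⟩ := h m hm
    have h₁ := h₁ .K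
    have h₂ := h₂ .L
    rw [hE.pub] at h₁
    rw [hE.absL] at h₂
    simp only [baseMeths, Finset.mem_insert, Finset.mem_singleton] at hb
    simp only [onlyOn, addNames, pubMeths] at h₁
    simp only [Set.mem_singleton_iff] at h₂
    simp at h₁
    tauto
  have hK : addNames e.A .K (v.names : Set Meth) .K = e.A .K ∪ (v.names : Set Meth) := by
    simp [addNames]
  have hL : addNames e.A .K (v.names : Set Meth) .L = e.A .L := by
    simp [addNames]
  refine ⟨{ hE with absL := hL.trans hE.absL, absK := ?_, absR := ?_ }, rfl, rfl, hK, hb⟩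
  · intro m hm
    rcases (show m ∈ e.A .K ∪ (v.names : Set Meth) from hK ▸ hm) with hm | hm
    · exact hE.absK m hm
    · exact hb m hm
  · intro Y m hm
    cases Y
    · rcases (show m ∈ e.A .K ∪ (v.names : Set Meth) from hK ▸ hm) with hm | hm
      · exact hE.absR .K m hm
      · exact (h m hm).2.2
    · exact hE.absR .L m (show m ∈ e.A .L from hL ▸ hm)

section ExtStep

variable {t : ℕ} {u f : Meth} {cur : Multiset ℤ} {e : Env} {stk : List Item} {N M' : Tm}
  {w : List XMove} {b : Bool} {pO pP : List Act} {R' : Repo} {S' : Store}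

/-- Calls of abstract methods occur only in states in which a `P`-move is due. -/
theorem Stuck.call (hE : EnvInv u f cur e) {E : ECtx} {m : Meth} {v : Val} {Y : Side}
    (h : Stuck t u e.R (e.A .K) f cur stk (E.plug (.appMeth m v.toTm)) w b pO pP)
    (hm : m ∈ e.A Y) :
    ∃ k, v = .int k ∧ pO = [] ∧ pP = [⟨.call, m, .int k, .P, Y⟩] ∧
      ThreadInv t u e.R (e.A .K) f cur ⟨.meth m :: .ctx E :: stk, none⟩ w b [] [] := by
  have hd := ECtx.decomp_plug (isRedex_appMeth m v) E
  generalize E.plug (.appMeth m v.toTm) = N at h hd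
  cases h with
  | emit stk N w b p h =>
    cases h with
    | ret => cases hd
    | callArg F fs w h₁ h₂ =>
      rw [ECtx.decomp_plug (r := .appMeth F.g (.int _)) rfl] at hd
      simp only [Option.some.injEq, Prod.mk.injEq, Tm.appMeth.injEq] at hd
      obtain ⟨rfl, rfl, hv⟩ := hd
      obtain rfl := Val.eq_of_toTm_eq_int hv.symm
      obtain rfl := hE.side_eq_of_mem (h₁ F (by simp)).1 hm
      exact ⟨_, rfl, rfl, rfl, .idle _ (F :: fs) w rfl h₁ h₂⟩
    | callFoo i fs w h₁ h₂ =>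
      rw [ECtx.decomp_plug (r := .appMeth foo (.int _)) rfl] at hd
      simp only [Option.some.injEq, Prod.mk.injEq, Tm.appMeth.injEq] at hd
      obtain ⟨rfl, rfl, hv⟩ := hd
      obtain rfl := Val.eq_of_toTm_eq_int hv.symm
      obtain rfl := hE.side_foo hm
      exact ⟨_, rfl, rfl, rfl, .inFoo i fs w h₁ h₂⟩
  | _ => cases hd

/-- Returns occur only in states in which a `P`-move is due. -/
theorem Stuck.ret {m : Meth} {𝓔 : List Item} {v : Val} {R : Repo} {G : Set Meth}
    (h : Stuck t u R G f cur (.meth m :: 𝓔) v.toTm w b pO pP) :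
    ∃ k, v = .int k ∧ pO = [] ∧ pP = [⟨.ret, m, .int k, .P, .K⟩] ∧
      ThreadInv t u R G f cur ⟨𝓔, none⟩ w b [] [] := by
  have hd := v.decomp_toTm
  generalize hv : v.toTm = N at h hd
  cases h with
  | emit stk N w b p h =>
    cases h with
    | ret m y fs w h₃ h₄ =>
      obtain rfl := Val.eq_of_toTm_eq_int hv
      exact ⟨_, rfl, rfl, rfl, .idle _ fs w rfl h₃ h₄⟩
    | callArg F => rw [ECtx.decomp_plug (r := .appMeth F.g (.int _)) rfl] at hd; cases hd
    | callFoo => rw [ECtx.decomp_plug (r := .appMeth foo (.int _)) rfl] at hd; cases hd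
  | _ => cases hd

/-- External transitions play the pending `P`-move or add a pending `O`-move. The hypothesis `henc`
expresses the encapsulation condition for the move. -/
theorem ThreadInv.extStep {C D : Comp} {e₁ : Env} {a : Act} (hE : EnvInv u f cur e)
    (h : ThreadInv t u e.R (e.A .K) f cur C w b pO pP) (hs : ExtStep a C e D e₁)
    (henc : a.who = .O → pO = [] → pP = [] → ∀ x ∈ w.getLast?, x.1.act.who = .P →
      x.1.act.side = a.side) :
    EnvInv u f cur e₁ ∧ e₁.R = e.R ∧ e₁.S = e.S ∧ e.A .K ⊆ e₁.A .K ∧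
    (∀ m ∈ a.val.names, m ∉ baseMeths) ∧
    ((a.who = .O ∧ pO = [] ∧ pP = [] ∧ ThreadInv t u e₁.R (e₁.A .K) f cur D w b [a] []) ∨
      (a.who = .P ∧ pO = [] ∧ pP = [a] ∧ ThreadInv t u e₁.R (e₁.A .K) f cur D w b [] [])) := by
  have hnames : ∀ k, ∀ m ∈ (Val.int k).names, m ∉ baseMeths := by simp [Val.names]
  cases hs with
  | pCall Y 𝓔 E m v v' e e' hm hv' hp =>
    cases h with
    | run stk M N w b pO pP hd h =>
      obtain rfl := hd.eq_of_detStep_eq_none (detStep_plug_appMeth (hE.absR Y m hm) E v)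
      obtain ⟨k, rfl, rfl, rfl, h'⟩ := h.call hE hm
      obtain ⟨rfl, rfl⟩ := passOut_int hp
      exact ⟨hE, rfl, rfl, subset_rfl, hnames k, .inr ⟨rfl, rfl, rfl, h'⟩⟩
  | pRet Y 𝓔 m v v' e e' hm hv' hp =>
    cases h with
    | run stk M N w b pO pP hd h =>
      obtain rfl := hd.eq_of_detStep_eq_none (detStep_toTm v)
      obtain ⟨k, rfl, rfl, rfl, h'⟩ := h.ret
      obtain ⟨rfl, rfl⟩ := passOut_int hp
      obtain ⟨rfl, -⟩ := hE.side_eq_K hm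
      exact ⟨hE, rfl, rfl, subset_rfl, hnames k, .inr ⟨rfl, rfl, rfl, h'⟩⟩
  | oCall Y 𝓔 m v x M e e' hm hv hR hp =>
    obtain ⟨rfl, hpub⟩ := hE.side_eq_K hm
    cases h with
    | inFoo i fs w h₁ h₂ =>
      -- a client call inside a call of `foo` would violate encapsulation
      have := henc rfl rfl rfl (xcall t foo (.int (cur.count i)) .P .L cur) (by simp) rfl
      cases this
    | idle stk fs w hstk h₁ h₂ =>
      obtain ⟨hE', hR', hS', hA', hb⟩ := hE.passIn hp
      have hG : e.A .K ⊆ e₁.A .K := hA' ▸ Set.subset_union_left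
      refine ⟨hE', hR', hS', hG, hb, .inl ⟨rfl, rfl, rfl, ?_⟩⟩
      have h₁' := h₁.mono hG
      subst hstk
      simp only [pubMeths, Finset.mem_insert, Finset.mem_singleton] at hpub
      rcases hpub with rfl | rfl | rfl
      · rw [hE.countDef] at hR
        cases hR
        obtain ⟨k, rfl⟩ := Val.eq_int_of_ty hv
        exact .run _ _ _ _ _ _ _ .refl (.countRead k fs w h₁' h₂)
      · rw [hE.updateDef] at hR
        cases hR
        obtain ⟨k, g, rfl, hg⟩ : ∃ k g, v = .pair (.int k) (.meth g) ∧ g.res = .int := by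
          cases v with
          | pair v₁ v₂ =>
            simp only [Val.ty, update, Ty.prod.injEq] at hv
            obtain ⟨k, rfl⟩ := Val.eq_int_of_ty hv.1
            cases v₂ <;> simp_all [Val.ty]
          | _ => simp [Val.ty, update] at hv
        have hg' : g ∈ e₁.A .K := by
          rw [hA']
          simp [Val.names]
        exact .run _ _ _ _ _ _ _ (detSteps_updateBody k g)
          (.updateRead k g fs w ⟨hg', hg⟩ h₁' h₂)
      · rw [hE.updateEncDef] at hR
        cases hR
        obtain ⟨k, rfl⟩ := Val.eq_int_of_ty hv
        exact .run _ _ _ _ _ _ _ .refl (.encAcquire k fs w h₁' h₂)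
  | oRet Y 𝓔 E m v e e' hm hv hp =>
    generalize hst : Item.meth m :: Item.ctx E :: 𝓔 = st at h
    cases h with
    | inFoo i fs w h₁ h₂ =>
      cases hst
      obtain ⟨k, rfl⟩ := Val.eq_int_of_ty hv
      obtain rfl := passIn_of_names_eq_empty rfl hp
      obtain rfl := hE.side_foo hm
      exact ⟨hE, rfl, rfl, subset_rfl, hnames k, .inl ⟨rfl, rfl, rfl,
        .run _ _ _ _ _ _ _ (detSteps_fooCtx i k) (.encReread i k fs w h₁ h₂)⟩⟩
    | idle _ fs w hstk h₁ h₂ =>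
      cases fs with
      | nil => cases hst.trans hstk
      | cons F fs =>
        cases hst.trans hstk
        obtain ⟨hg, hres⟩ := h₁ F (by simp)
        obtain ⟨k, rfl⟩ := Val.eq_int_of_ty (hv.trans hres)
        obtain rfl := passIn_of_names_eq_empty rfl hp
        obtain rfl := hE.side_eq_of_mem hg hm
        exact ⟨hE, rfl, rfl, subset_rfl, hnames k, .inl ⟨rfl, rfl, rfl,
          .run _ _ _ _ _ _ _ (detSteps_argCtx F.i F.g _ k) (.updateAcquire F k fs w h₁ h₂)⟩⟩

end ExtStep

/-! ### The simulation -/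

theorem proj_append (a b : List Move) (t : ℕ) : proj (a ++ b) t = proj a t ++ proj b t := by
  simp [proj]

theorem proj_singleton_self (t : ℕ) (a : Act) : proj [⟨t, a⟩] t = [a] := by
  simp [proj]

theorem proj_singleton_of_ne {t t' : ℕ} (h : t' ≠ t) (a : Act) : proj [⟨t', a⟩] t = [] := by
  simp [proj, h]

theorem proj_eq_nil {h : List Move} {t : ℕ} : proj h t = [] ↔ ∀ x ∈ h, x.thread ≠ t := by
  simp [proj, List.filter_eq_nil_iff]

theorem exists_of_proj_eq_singleton {h : List Move} {t : ℕ} {a : Act} (hh : proj h t = [a]) :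
    ∃ l r, h = l ++ ⟨t, a⟩ :: r ∧ proj l t = [] ∧ proj r t = [] := by
  obtain ⟨x, s, hs, hx, hs'⟩ := List.map_eq_cons_iff.1 hh
  obtain ⟨l, r, rfl, hl, hxt, hr⟩ := List.filter_eq_cons_iff.1 hs
  have hxt : x.thread = t := by simpa using hxt
  subst hxt
  subst hx
  refine ⟨l, r, rfl, proj_eq_nil.2 fun y hy => by simpa using hl y hy, ?_⟩
  rw [proj, hr]
  exact hs'

/-- The invariant of a run of the library with the trace `h`. It is witnessed by a linearisation
`s`, the `O`-moves `pO` that are not part of it, and the `P`-moves `pP` that are part of it but have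
not been played. The lock is held by the thread `k`, if any. -/
structure RunInv {N : ℕ} (u f : Meth) (cur : Multiset ℤ) (s : List XMove) (pO pP : List Move)
    (k : Option ℕ) (C : Fin N → Comp) (e : Env) (h : List Move) : Prop where
  env : EnvInv u f cur e
  lin : Linear cur s
  reorders : Reorders (h ++ pP) (s.map Prod.fst ++ pO)
  lock : e.S lockRef = some (.int (if k = none then 0 else 1))
  threads : ∀ i : Fin N, ThreadInv ((i : ℕ) + 1) u e.R (e.A .K) f cur (C i)
    (xofThread ((i : ℕ) + 1) s) (decide (k = some ((i : ℕ) + 1)))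
    (proj pO ((i : ℕ) + 1)) (proj pP ((i : ℕ) + 1))
  range : ∀ t, (∀ i : Fin N, t ≠ (i : ℕ) + 1) → xofThread t s = [] ∧ proj pO t = [] ∧
    proj pP t = []
  whoO : ∀ x ∈ pO, x.act.who = .O
  whoP : ∀ x ∈ pP, x.act.who = .P
  names : ∀ x ∈ h, ∀ m ∈ x.act.val.names, m ∉ baseMeths

section Simulation

variable {N : ℕ} {u f : Meth} {cur : Multiset ℤ} {s : List XMove} {pO pP : List Move}
  {k : Option ℕ} {C : Fin N → Comp} {e : Env} {h : List Move}

/-- Internal steps preserve the invariant. At a linearisation point, the pending `O`-move of the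
thread and the `P`-move that answers it are appended to the linearisation. -/
theorem RunInv.intStep (H : RunInv u f cur s pO pP k C e h) {i : Fin N} {D : Comp} {e₁ : Env}
    (hs : IntStep ((i : ℕ) + 1) (C i) e D e₁) :
    ∃ f' cur' s' pO' pP' k', RunInv u f' cur' s' pO' pP' k' (Function.update C i D) e₁ h := by
  obtain ⟨f', cur', w', b', qO, qP, hE, hT, hR, hA, hlock, hb, hlin⟩ :=
    (H.threads i).intStep H.env hs
  have hne : ∀ j : Fin N, j ≠ i → ((i : ℕ) + 1) ≠ (j : ℕ) + 1 := fun j hj h =>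
    hj (Fin.ext (by omega))
  -- the new holder of the lock
  obtain ⟨k', hk', hki, hkj⟩ : ∃ k' : Option ℕ,
      e₁.S lockRef = some (.int (if k' = none then 0 else 1)) ∧
      b' = decide (k' = some ((i : ℕ) + 1)) ∧
      ∀ j : Fin N, j ≠ i → (k' = some ((j : ℕ) + 1) ↔ k = some ((j : ℕ) + 1)) := by
    rcases hlock with ⟨h₁, h₂⟩ | ⟨h₁, rfl, h₂, h₃⟩ | ⟨h₁, rfl, h₂⟩
    · exact ⟨k, h₂.trans H.lock, h₁, fun _ _ => Iff.rfl⟩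
    · have hk : k = none := by
        rw [H.lock] at h₂
        by_contra hk
        simp [hk] at h₂
      refine ⟨some ((i : ℕ) + 1), by simpa using h₃, by simp, fun j hj => ?_⟩
      simpa [hk] using hne j hj
    · have hk : k = some ((i : ℕ) + 1) := by simpa using h₁
      refine ⟨none, by simpa using h₂, by simp, fun j hj => ?_⟩
      simpa [hk] using hne j hj
  -- the other threads are not affected by the step
  have hother : ∀ j : Fin N, j ≠ i → ThreadInv ((j : ℕ) + 1) u e₁.R (e₁.A .K) f' cur' (C j)
      (xofThread ((j : ℕ) + 1) s) (decide (k' = some ((j : ℕ) + 1)))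
      (proj pO ((j : ℕ) + 1)) (proj pP ((j : ℕ) + 1)) := by
    intro j hj
    rw [decide_eq_decide.2 (hkj j hj)]
    refine (H.threads j).mono hR (by rw [hA]) ?_
    rcases hb with hb | hb
    · left
      have : k = some ((i : ℕ) + 1) := by simpa using hb
      simpa [this] using hne j hj
    · exact .inr hb
  subst hki
  generalize hw : xofThread ((i : ℕ) + 1) s = w at hlin
  generalize hqO : proj pO ((i : ℕ) + 1) = qO₀ at hlin
  generalize hqP : proj pP ((i : ℕ) + 1) = qP₀ at hlin
  cases hlin with
  | silent =>
    refine ⟨f', cur, s, pO, pP, k', hE, H.lin, H.reorders, hk', fun j => ?_, H.range, H.whoO,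
      H.whoP, H.names⟩
    by_cases hj : j = i
    · subst hj
      rw [Function.update_self, hw, hqO, hqP]
      exact hT
    · rw [Function.update_of_ne hj]
      exact hother j hj
  | point _ _ o p ho hp =>
    obtain ⟨l, r, rfl, hl, hr⟩ := exists_of_proj_eq_singleton hqO
    refine ⟨f', cur', s ++ [(⟨(i : ℕ) + 1, o⟩, cur), (⟨(i : ℕ) + 1, p⟩, cur')], l ++ r,
      pP ++ [⟨(i : ℕ) + 1, p⟩], k', hE, H.lin.snoc _ _ _ _ _ _ ho hp, ?_, hk', fun j => ?_,
      fun t ht => ?_, fun x hx => H.whoO x ?_, fun x hx => ?_, H.names⟩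
    · have h₁ := H.reorders.append_right [⟨(i : ℕ) + 1, p⟩]
      -- the `P`-move moves before the later pending `O`-moves
      have h₂ : Reorders (r ++ [⟨(i : ℕ) + 1, p⟩]) (⟨(i : ℕ) + 1, p⟩ :: (r ++ [])) :=
        reorders_move_earlier (fun y hy => ⟨proj_eq_nil.1 hr y hy, .inr hp⟩) []
      -- the earlier pending `O`-moves move after the pair
      have h₃ : Reorders (l ++ ⟨(i : ℕ) + 1, p⟩ :: r) (⟨(i : ℕ) + 1, p⟩ :: (l ++ r)) :=
        reorders_move_earlier (fun y hy => ⟨proj_eq_nil.1 hl y hy, .inr hp⟩) r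
      have h₄ : Reorders (l ++ ⟨(i : ℕ) + 1, o⟩ :: (⟨(i : ℕ) + 1, p⟩ :: r))
          (⟨(i : ℕ) + 1, o⟩ :: (l ++ ⟨(i : ℕ) + 1, p⟩ :: r)) :=
        reorders_move_earlier (fun y hy => ⟨proj_eq_nil.1 hl y hy,
          .inl (H.whoO y (by simp [hy]))⟩) _
      have h₅ := Reorders.append_left (h₄.trans (h₃.append_left [⟨(i : ℕ) + 1, o⟩])) (s.map Prod.fst)
      have h₆ := h₂.append_left (s.map Prod.fst ++ l ++ [⟨(i : ℕ) + 1, o⟩])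
      simp only [List.append_assoc, List.append_nil, List.cons_append, List.nil_append,
        List.map_append, List.map_cons, List.map_nil] at h₁ h₅ h₆ ⊢
      exact (h₁.trans h₆).trans h₅
    · by_cases hj : j = i
      · subst hj
        rw [Function.update_self]
        have h₁ : xofThread ((j : ℕ) + 1)
            (s ++ [(⟨(j : ℕ) + 1, o⟩, cur), (⟨(j : ℕ) + 1, p⟩, cur')]) =
            w ++ [(⟨(j : ℕ) + 1, o⟩, cur), (⟨(j : ℕ) + 1, p⟩, cur')] := by
          simp [← hw]
        rw [h₁, proj_append, hl, hr, proj_append, hqP, proj_singleton_self]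
        exact hT
      · rw [Function.update_of_ne hj]
        have hij := hne j hj
        have h₁ : xofThread ((j : ℕ) + 1)
            (s ++ [(⟨(i : ℕ) + 1, o⟩, cur), (⟨(i : ℕ) + 1, p⟩, cur')]) =
            xofThread ((j : ℕ) + 1) s := by
          simp [Nat.succ_injective.ne_iff.1 hij]
        have h₂ := hother j hj
        rw [← List.singleton_append, proj_append, proj_append, proj_singleton_of_ne hij,
          List.nil_append, ← proj_append] at h₂
        rw [h₁, proj_append pP, proj_singleton_of_ne hij, List.append_nil]
        exact h₂
    · obtain ⟨h₁, h₂, h₃⟩ := H.range t ht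
      have hti := (ht i).symm
      rw [← List.singleton_append, proj_append, proj_append, proj_singleton_of_ne hti,
          List.nil_append, ← proj_append] at h₂
      refine ⟨?_, h₂, ?_⟩
      · simp only [xofThread, List.filter_append] at h₁ ⊢
        rw [h₁]
        simp [hti]
      · rw [proj_append, h₃, proj_singleton_of_ne hti, List.append_nil]
    · simp only [List.mem_append, List.mem_cons] at hx ⊢
      tauto
    · simp only [List.mem_append, List.mem_singleton] at hx
      rcases hx with hx | rfl
      · exact H.whoP x hx
      · exact hp

/-- External transitions preserve the invariant and leave the linearisation unchanged. -/
theorem RunInv.extStep (H : RunInv u f cur s pO pP k C e h) {i : Fin N} {a : Act} {D : Comp}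
    {e₁ : Env} (hs : ExtStep a (C i) e D e₁) {s' : List Move}
    (henc : Encapsulated (h ++ ⟨(i : ℕ) + 1, a⟩ :: s')) :
    ∃ pO' pP', RunInv u f cur s pO' pP' k (Function.update C i D) e₁
      (h ++ [⟨(i : ℕ) + 1, a⟩]) := by
  have hfilter := H.reorders.ofThread_eq ((i : ℕ) + 1)
  obtain ⟨hE, hR, hS, hG, hnames, hcase⟩ := (H.threads i).extStep H.env hs (by
    intro ha hO hP x hx hxP
    have h₁ : ∀ {l : List Move}, proj l ((i : ℕ) + 1) = [] → ofThread ((i : ℕ) + 1) l = [] :=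
      fun hl => List.map_eq_nil_iff.1 hl
    have h₂ : ofThread ((i : ℕ) + 1) h = (xofThread ((i : ℕ) + 1) s).map Prod.fst := by
      rw [map_fst_xofThread]
      simpa only [ofThread, List.filter_append, h₁ hO, h₁ hP, List.append_nil] using hfilter
    refine henc.side_eq (x := x.1) (y := ⟨(i : ℕ) + 1, a⟩) ?_ hxP ha
    rw [h₂, List.getLast?_map, hx]
    rfl)
  have hne : ∀ j : Fin N, j ≠ i → ((i : ℕ) + 1) ≠ (j : ℕ) + 1 := fun j hj h =>
    hj (Fin.ext (by omega))
  have hmono : ∀ j : Fin N, ThreadInv ((j : ℕ) + 1) u e₁.R (e₁.A .K) f cur (C j)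
      (xofThread ((j : ℕ) + 1) s) (decide (k = some ((j : ℕ) + 1)))
      (proj pO ((j : ℕ) + 1)) (proj pP ((j : ℕ) + 1)) := fun j =>
    (H.threads j).mono (hR ▸ Repo.le_refl _) hG (.inr ⟨rfl, rfl⟩)
  have hn : ∀ x ∈ h ++ [⟨(i : ℕ) + 1, a⟩], ∀ m ∈ x.act.val.names, m ∉ baseMeths := by
    intro x hx
    simp only [List.mem_append, List.mem_singleton] at hx
    rcases hx with hx | rfl
    · exact H.names x hx
    · exact hnames
  rcases hcase with ⟨ha, hO, hP, hT⟩ | ⟨ha, hO, hP, hT⟩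
  · refine ⟨pO ++ [⟨(i : ℕ) + 1, a⟩], pP, hE, H.lin, ?_, by rw [hS]; exact H.lock, fun j => ?_,
      fun t ht => ?_, fun x hx => ?_, H.whoP, hn⟩
    · have h₁ : Reorders (⟨(i : ℕ) + 1, a⟩ :: (pP ++ [])) (pP ++ [⟨(i : ℕ) + 1, a⟩]) :=
        reorders_move_later (fun y hy => ⟨proj_eq_nil.1 hP y hy, .inl ha⟩) []
      have h₂ := (h₁.append_left h).trans
        (by simpa using H.reorders.append_right [⟨(i : ℕ) + 1, a⟩])
      simpa using h₂
    · by_cases hj : j = i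
      · subst hj
        rw [Function.update_self, proj_append, hO, hP, proj_singleton_self]
        exact hT
      · rw [Function.update_of_ne hj, proj_append, proj_singleton_of_ne (hne j hj),
          List.append_nil]
        exact hmono j
    · obtain ⟨h₁, h₂, h₃⟩ := H.range t ht
      refine ⟨h₁, ?_, h₃⟩
      rw [proj_append, h₂, proj_singleton_of_ne (ht i).symm, List.append_nil]
    · simp only [List.mem_append, List.mem_singleton] at hx
      rcases hx with hx | rfl
      · exact H.whoO x hx
      · exact ha
  · obtain ⟨l, r, rfl, hl, hr⟩ := exists_of_proj_eq_singleton hP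
    have hsplit : ∀ t, (i : ℕ) + 1 ≠ t → proj (l ++ ⟨(i : ℕ) + 1, a⟩ :: r) t = proj (l ++ r) t := by
      intro t ht
      rw [← List.singleton_append, proj_append, proj_append, proj_singleton_of_ne ht,
        List.nil_append, ← proj_append]
    refine ⟨pO, l ++ r, hE, H.lin, ?_, by rw [hS]; exact H.lock, fun j => ?_,
      fun t ht => ?_, H.whoO, fun x hx => H.whoP x ?_, hn⟩
    · have h₁ : Reorders (⟨(i : ℕ) + 1, a⟩ :: (l ++ r)) (l ++ ⟨(i : ℕ) + 1, a⟩ :: r) :=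
        reorders_move_later (fun y hy => ⟨proj_eq_nil.1 hl y hy,
          .inr (H.whoP y (by simp [hy]))⟩) r
      simpa using (h₁.append_left h).trans H.reorders
    · by_cases hj : j = i
      · subst hj
        rw [Function.update_self, proj_append, hl, hr, hO]
        exact hT
      · rw [Function.update_of_ne hj, ← hsplit _ (hne j hj)]
        exact hmono j
    · obtain ⟨h₁, h₂, h₃⟩ := H.range t ht
      exact ⟨h₁, h₂, by rw [← hsplit _ (ht i).symm]; exact h₃⟩
    · simp only [List.mem_append, List.mem_cons] at hx ⊢
      tauto

/-- At the end of a run, the linearisation is complete. -/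
theorem RunInv.final (H : RunInv u f cur s pO pP k C e h) (hC : ∀ i, (C i).Final) :
    Reorders h (s.map Prod.fst) ∧ ∀ t, SpecS t (xofThread t s) := by
  have hT : ∀ i : Fin N, SpecS ((i : ℕ) + 1) (xofThread ((i : ℕ) + 1) s) ∧
      proj pO ((i : ℕ) + 1) = [] ∧ proj pP ((i : ℕ) + 1) = [] := by
    intro i
    have h₁ := H.threads i
    have hi := hC i
    generalize C i = D at h₁ hi
    generalize proj pO ((i : ℕ) + 1) = qO at h₁ ⊢
    generalize proj pP ((i : ℕ) + 1) = qP at h₁ ⊢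
    generalize xofThread ((i : ℕ) + 1) s = w at h₁ ⊢
    generalize decide (k = some ((i : ℕ) + 1)) = b at h₁
    cases h₁ with
    | idle stk fs w hstk _ hw =>
      have : stk = [] := by rcases hi with hi | hi <;> cases hi; rfl
      cases fs with
      | nil =>
        cases hw with
        | nil _ hw => exact ⟨hw, rfl, rfl⟩
      | cons F fs => rw [this] at hstk; cases hstk
    | inFoo => rcases hi with hi | hi <;> cases hi
    | run stk M N w b qO qP _ hst =>
      have : stk = [] := by rcases hi with hi | hi <;> cases hi; rfl
      subst this
      cases hst with
      | release _ _ _ _ _ h => cases h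
      | emit _ _ _ _ _ h => cases h
  have hT' : ∀ t, SpecS t (xofThread t s) ∧ proj pO t = [] ∧ proj pP t = [] := by
    intro t
    by_cases ht : ∃ i : Fin N, t = (i : ℕ) + 1
    · obtain ⟨i, rfl⟩ := ht
      exact hT i
    · obtain ⟨h₁, h₂, h₃⟩ := H.range t fun i hi => ht ⟨i, hi⟩
      exact ⟨h₁ ▸ .nil, h₂, h₃⟩
  refine ⟨?_, fun t => (hT' t).1⟩
  have hnil : ∀ {l : List Move}, (∀ t, proj l t = []) → l = [] := by
    intro l hl
    refine List.eq_nil_iff_forall_not_mem.2 fun x hx => ?_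
    exact proj_eq_nil.1 (hl x.thread) x hx rfl
  have := H.reorders
  rwa [hnil fun t => (hT' t).2.1, hnil fun t => (hT' t).2.2, List.append_nil,
    List.append_nil] at this

/-- The trace of a complete run is reordered to its linearisation. -/
theorem RunInv.run {C' : Fin N → Comp} {e' : Env} {r : List Move} (hr : Run C e r C' e')
    (hC : ∀ i, (C' i).Final) {f : Meth} {cur : Multiset ℤ} {s : List XMove} {pO pP : List Move}
    {k : Option ℕ} {h : List Move} (H : RunInv u f cur s pO pP k C e h)
    (henc : Encapsulated (h ++ r)) :
    ∃ cur' s', Linear cur' s' ∧ Reorders (h ++ r) (s'.map Prod.fst) ∧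
      (∀ t, SpecS t (xofThread t s')) ∧ ∀ x ∈ h ++ r, ∀ m ∈ x.act.val.names, m ∉ baseMeths := by
  induction hr generalizing f cur s pO pP k h with
  | refl C e =>
    rw [List.append_nil]
    obtain ⟨h₁, h₂⟩ := H.final hC
    exact ⟨cur, s, H.lin, h₁, h₂, H.names⟩
  | int C e i D e₁ r C' e' hs _ _ ih =>
    obtain ⟨f', cur', s', pO', pP', k', H'⟩ := H.intStep hs
    exact ih hC H' henc
  | ext C e i a D e₁ r C' e' hs _ ih =>
    obtain ⟨pO', pP', H'⟩ := H.extStep hs henc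
    have := ih hC H' (by simpa using henc)
    simpa using this

end Simulation

/-! ### Initial configurations and typing -/

theorem names_Lmset2 : Lmset2.names = baseMeths := by decide

/-- The evaluation of the library binds its methods and the two functions stored in references. -/
theorem evaluates_Lmset2 {R : Repo} {S : Store} (h : Lmset2.Evaluates R S) :
    ∃ u f : Meth, u ∉ baseMeths ∧ f ∉ baseMeths ∧ R count = some (vi, countBody) ∧
      R update = some (vp, updateBody) ∧ R updateEnc = some (vi, updateEncBody) ∧
      R u = some (vp, updRBody) ∧ R f = some (vx, .int 0) ∧ R foo = none ∧
      S updR = some (.meth u) ∧ S refF = some (.meth f) ∧ S lockRef = some (.int 0) := by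
  rw [Lib.Evaluates, names_Lmset2] at h
  unfold Lmset2 at h
  iterate 5
    obtain h | ⟨_, hs, h⟩ := Relation.ReflTransGen.cases_head h
    · cases h
    cases hs
  obtain h | ⟨_, hs, h⟩ := Relation.ReflTransGen.cases_head h
  · cases h
  generalize hr : Block.refFn refF _ _ _ = B at hs
  obtain _ | _ | _ | _ | ⟨_, _, _, _, _, _, _, _, f, -, -, -, hf⟩ := hs <;> cases hr
  iterate 2
    obtain h | ⟨_, hs, h⟩ := Relation.ReflTransGen.cases_head h
    · cases h
    cases hs
  obtain h | ⟨_, hs, h⟩ := Relation.ReflTransGen.cases_head h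
  · cases h
  generalize hr : Block.refFn updR _ _ _ = B at hs
  obtain _ | _ | _ | _ | ⟨_, _, _, _, _, _, _, _, u, -, -, hu', hu⟩ := hs <;> cases hr
  obtain h | ⟨_, hs, h⟩ := Relation.ReflTransGen.cases_head h
  · cases h
  cases hs
  obtain h | ⟨_, hs, h⟩ := Relation.ReflTransGen.cases_head h
  · cases h
    have hf' := hf
    have hu'' := hu
    simp only [baseMeths, Finset.mem_insert, Finset.mem_singleton, not_or] at hf' hu''
    obtain ⟨f₁, f₂, f₃, f₄⟩ := hf'
    obtain ⟨u₁, u₂, u₃, u₄⟩ := hu''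
    have hfu : f ≠ u := by
      rintro rfl
      simp [f₁, f₂] at hu'
    have c₁ : foo ≠ updateEnc := by decide
    have c₂ : foo ≠ update := by decide
    have c₃ : foo ≠ count := by decide
    have c₄ : count ≠ updateEnc := by decide
    have c₅ : count ≠ update := by decide
    have c₆ : update ≠ updateEnc := by decide
    refine ⟨u, f, hu, hf, ?_⟩
    simp [Ne.symm u₁, Ne.symm u₂, u₃, Ne.symm u₄, f₁, f₂, f₃, Ne.symm f₄,
      hfu, c₁, c₂, c₃, c₄, c₅, c₆, updR, refF, lockRef]
  · cases hs

theorem libTy_Lmset2 : LibTy ∅ Lmset2 absMeths pubMeths := by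
  have hF : ∀ Γ, HasTy Γ (.deref refF) (.arrow .int .int) := fun Γ => .deref Γ refF
  have hU : ∀ Γ, HasTy Γ (.deref updR)
    (.arrow (.prod .int (.prod (.arrow .int .int) .int)) .int) := fun Γ => .deref Γ updR
  have h₁ : HasTy (single vi .int) countBody .int := by
    repeat' first | rfl | exact hF _ | exact hU _ | constructor
  have h₂ : HasTy (single vp update.arg) updateBody .int := by
    repeat' first | rfl | exact hF _ | exact hU _ | constructor
  have h₃ : HasTy (single vp (.prod .int (.prod (.arrow .int .int) .int))) updRBody .int := by
    repeat' first | rfl | exact hF _ | exact hU _ | constructor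
  have h₄ : HasTy (single vi .int) updateEncBody .int := by
    repeat' first | rfl | exact hF _ | exact hU _ | constructor
  have hB : BlockTy _ pubMeths := .refInt 0 0 _ _ <| .refFn .int .int 0 vx (.int 0) _ _ (.int _ _) <|
    .meth count vi countBody _ _ h₁ (.meth update vp updateBody _ {updateEnc} h₂
      (.refFn _ .int 0 vp updRBody _ _ h₃ (.meth updateEnc vi updateEncBody .nil ∅ h₄ .nil
        (by decide))) (by decide)) (by decide)
  have hL := LibTy.block _ _ hB
  refine .pub ∅ count _ _ _ (by decide) (.pub _ update _ _ _ (by decide) (.pub _ updateEnc _ _ _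
    (by decide) (.abs _ foo _ ∅ _ (by decide) ?_ (by decide) (by decide)) (by decide)) (by decide))
    (by decide)
  convert hL using 1
  · decide
  · rfl

theorem amset2_subset : Amset2 ⊆ HistSeq absMeths pubMeths ∩ HistEnc absMeths pubMeths := by
  rintro _ ⟨s, hs, rfl⟩
  exact ⟨hs.seq, hs.seq.1, encapsulated_of_specS hs.thread⟩

theorem exists_encLinBy {h : List Move} (hh : h ∈ semEnc absMeths pubMeths Lmset2) :
    ∃ h' ∈ Amset2, EncLinBy absMeths pubMeths h h' := by
  obtain ⟨⟨N, -, R, S, C, e, hev, hrun, hC⟩, hH, henc⟩ := hh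
  obtain ⟨u, f, hu, hf, h₁, h₂, h₃, h₄, h₅, h₆, h₇, h₈, h₉⟩ := evaluates_Lmset2 hev
  have H : RunInv (N := N) u f 0 [] [] [] none (fun _ => ⟨[], none⟩)
      ⟨R, onlyOn .K pubMeths, onlyOn .L absMeths, S⟩ [] := by
    refine ⟨⟨h₁, h₂, h₃, h₄, h₇, h₈, ?_, rfl, ?_, ?_, ?_⟩, .nil, .refl, h₉, fun i => ?_,
      fun t _ => ⟨rfl, rfl, rfl⟩, by simp, by simp, by simp⟩
    · simpa using represents_zero h₅
    · simp [onlyOn, addNames, absMeths]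
    · simp [onlyOn, addNames]
    · rintro (_ | _) m hm
      · simp [onlyOn, addNames] at hm
      · obtain rfl : m = foo := by simpa [onlyOn, addNames, absMeths] using hm
        exact h₆
    · exact .idle [] [] [] rfl (by simp [FramesIn]) (.nil _ .nil)
  obtain ⟨cur, s, hlin, hr, hs, hn⟩ := H.run hrun hC henc
  rw [List.nil_append] at hr hn
  have hl := threadLocal_of_specS hH hn hr.ofThread_eq hs
  have hH' := hH.of_ofThread_eq hl hr.ofThread_eq
  have hext := hlin.specExt hH' hs
  exact ⟨_, ⟨s, hext, rfl⟩, ⟨hH, henc⟩, ⟨hH', encapsulated_of_specS hs⟩, hr.enc_swaps hH hl,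
    hext.seq⟩

end HOLin


theorem mainTheorem10 :
    HOLin.EncLinearises HOLin.absMeths HOLin.pubMeths HOLin.Lmset2 HOLin.Amset2 :=
  ⟨HOLin.libTy_Lmset2, HOLin.amset2_subset, fun _ => HOLin.exists_encLinBy⟩
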